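/- Let $H$ be a separable infinite-dimensional complex Hilbert space with norm $\|\cdot\|$, and let $\Gamma$ be a positive, unbounded self-adjoint operator on $H$ with discrete spectrum: its eigenvalues, repeated according to multiplicity, are $0<\lambda_1\le\lambda_2\le\cdots$ with $\lambda_j\to\infty$, and $e_1,e_2,\dots$ are corresponding orthonormal eigenvectors forming a basis of $H$. For $m\in\{0,1,2,\dots\}$ let $H^m(\Gamma)$ be the space of all $\psi=\sum_j c_je_j\in H$ with $\|\psi\|_m^2=\sum_j\lambda_j^m|c_j|^2<\infty$. Let $L$ be a symmetric operator on $H$ with domain $D(L)\supseteq H^1(\Gamma)$ such that, for some constant $C$, $\|L\psi\|\le C\|\psi\|_1$ for all $\psi\in H^1(\Gamma)$. For $A\in\mathbb R$ and $\phi_0\in H$, a solution of $$\partial_t\phi^A(t)=iAL\phi^A(t)-\Gamma\phi^A(t),\qquad \phi^A(0)=\phi_0,$$ is a function $\phi^A:[0,\infty)\to H$ that is continuous in norm, has $\phi^A(0)=\phi_0$, and for every $t>0$ satisfies $\phi^A(t)\in D(\Gamma)\cap D(L)$ and the equation, with the derivative taken in the norm of $H$. Then for every $A\in\mathbb R$ and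 every $\phi_0\in H$ there is exactly one solution $\phi^A$, and the following two statements are equivalent: 1. For every $\tau>0$ and $\delta>0$ there exists $A(\tau,\delta)$ such that for every $A>A(\tau,\delta)$ and every $\phi_0\in H$ with $\|\phi_0\|=1$, the solution $\phi^A$ satisfies $\|\phi^A(\tau)\|<\delta$. 2. The operator $L$ has no eigenvectors lying in $H^1(\Gamma)$. (No bound on $e^{iLt}$ in $H^1(\Gamma)$ is assumed.) -/

import Mathlib

open Set Filter Topology

noncomputable section

namespace RelaxationEnhancing

variable {H : Type*} [NormedAddCommGroup H] [InnerProductSpace ℂ H]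

/-- `Γ` has discrete spectrum `0 < lam 0 ≤ lam 1 ≤ ⋯ → ∞` (each eigenvalue repeated according
to its finite multiplicity), and `e 0, e 1, …` are corresponding orthonormal eigenvectors which
form a basis of `H`. -/
structure HasPositiveDiscreteSpectrum (Γ : H →ₗ.[ℂ] H) (lam : ℕ → ℝ) (e : HilbertBasis ℕ ℂ H) :
    Prop where
  pos : 0 < lam 0
  mono : Monotone lam
  tendsto : Tendsto lam atTop atTop
  eigen : ∀ j, ∃ h : e j ∈ Γ.domain, Γ ⟨e j, h⟩ = (lam j : ℂ) • e j

/-- The homogeneous Sobolev space `H^m(Γ)`: all `ψ = ∑ j, c j • e j` in `H` such that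
`∑ j, lam j ^ m * |c j| ^ 2 < ∞`. -/
def sobolevSpace (lam : ℕ → ℝ) (e : HilbertBasis ℕ ℂ H) (m : ℕ) : Set H :=
  {ψ | Summable fun j => lam j ^ m * ‖e.repr ψ j‖ ^ 2}

/-- The norm `‖ψ‖_m = (∑ j, lam j ^ m * |c j| ^ 2) ^ (1 / 2)` of `H^m(Γ)`; it is meaningful for
`ψ ∈ sobolevSpace lam e m` only. -/
def sobolevNorm (lam : ℕ → ℝ) (e : HilbertBasis ℕ ℂ H) (m : ℕ) (ψ : H) : ℝ :=
  Real.sqrt (∑' j, lam j ^ m * ‖e.repr ψ j‖ ^ 2)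

/-- `L` is symmetric: `⟨L x, y⟩ = ⟨x, L y⟩` for all `x, y ∈ D(L)`. -/
def IsSymmetricOp (L : H →ₗ.[ℂ] H) : Prop :=
  ∀ x y : L.domain, inner ℂ (L x) (y : H) = inner ℂ (x : H) (L y)

/-- `φ` solves `∂ₜ φ = i A L φ - Γ φ` on `[0, ∞)` with `φ 0 = φ₀`: it is norm continuous on
`[0, ∞)`, and for every `t > 0` the vector `φ t` lies in the domains of `Γ` and `L` and the
equation holds with the derivative taken in the norm of `H`. -/
structure IsSolution (Γ L : H →ₗ.[ℂ] H) (A : ℝ) (φ₀ : H) (φ : ℝ → H) : Prop where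
  initial : φ 0 = φ₀
  continuousOn : ContinuousOn φ (Ici 0)
  equation : ∀ t : ℝ, 0 < t → ∃ (hΓ : φ t ∈ Γ.domain) (hL : φ t ∈ L.domain),
    HasDerivAt φ ((Complex.I * (A : ℂ)) • L ⟨φ t, hL⟩ - Γ ⟨φ t, hΓ⟩) t

/-- `ψ` is an eigenvector of `L`. -/
def IsEigenvector (L : H →ₗ.[ℂ] H) (ψ : H) : Prop :=
  ψ ≠ 0 ∧ ∃ (h : ψ ∈ L.domain) (μ : ℂ), L ⟨ψ, h⟩ = μ • ψ

end RelaxationEnhancing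

end

/-! Since `L` is symmetric, the term `i A L` does not change the norm and only `Γ` dissipates: `d/dt
‖φ‖² = -2 ‖φ‖₁²`. This gives uniqueness, monotone norms and, for unit data, `∫ ‖φ‖₁² ≤ 1/2` with a
bound independent of `A`.

Existence comes from Galerkin truncation to the span of the first `N` eigenvectors of `Γ`. The part
of `L u` lost by truncating lies in modes of index at least `N`, which are damped at rate at least
`lam N`, so the approximations are uniformly Cauchy (`normSq_expFlow_sub_le`). A smoothing estimate
(`norm_generator_expFlow_le`), applied twice, bounds second time derivatives away from `t = 0`; by
interpolation the first derivatives converge too, and the limit is a solution in the strong sense.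

An eigenvector `ψ ∈ H^1` obstructs relaxation: `L` only rotates the phase of `⟨ψ, φ⟩`, so its
modulus changes at a rate controlled by `‖ψ‖₁² + ‖φ‖₁²`, uniformly in `A`
(`IsSolution.normSq_ge_of_isEigenvector`).

Conversely, suppose that solutions `φ n` with unit data and `A n → ∞` keep norm at least `δ` at time
`τ`. No analysis of `e^{iLt}` is needed. The positive operators `K n = ∫₀^τ ⟨φ n, ·⟩ φ n dt` have a
weak limit `K`. The energy bound gives `tr (Γ K) ≤ 1/2`, so `K` is compact with range in `H^1`, and
no mass escapes to high modes, so `K ≠ 0`. Dividing the evolution equation of `⟨e i, φ⟩⟨φ, e j⟩` by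
`A` shows that `K` commutes with `L`. An eigenspace of `K` for a nonzero eigenvalue is then
finite-dimensional, contained in `H^1` and invariant under `L`, so it contains an eigenvector of `L`
(`exists_isEigenvector_of_commute`). -/

namespace RelaxationEnhancing

/-! ### Bounded generators `i T - S²`: energy identity and smoothing. -/

section Flow

variable {H : Type*} [NormedAddCommGroup H] [InnerProductSpace ℂ H]

theorem hasDerivAt_normSq {u : ℝ → H} {u' : H} {t : ℝ} (h : HasDerivAt u u' t) :
    HasDerivAt (fun s => ‖u s‖ ^ 2) (2 * (inner ℂ (u t) u').re) t := by
  let _ : InnerProductSpace ℝ H := InnerProductSpace.complexToReal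
  have := h.norm_sq
  rwa [real_inner_eq_re_inner ℂ] at this

/-- A continuous function on `[a, ∞)` with nonpositive derivative on `(a, ∞)` is nonincreasing. -/
theorem antitoneOn_Ici_of_hasDerivAt {f f' : ℝ → ℝ} {a : ℝ} (hc : ContinuousOn f (Ici a))
    (hd : ∀ t, a < t → HasDerivAt f (f' t) t) (hn : ∀ t, a < t → f' t ≤ 0) :
    AntitoneOn f (Ici a) := by
  refine antitoneOn_of_deriv_nonpos (convex_Ici a) hc ?_ ?_
  · intro t ht
    rw [interior_Ici] at ht
    exact (hd t ht).differentiableAt.differentiableWithinAt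
  · intro t ht
    rw [interior_Ici] at ht
    rw [(hd t ht).deriv]
    exact hn t ht

theorem antitoneOn_Icc_of_hasDerivAt {f f' : ℝ → ℝ} {a b : ℝ} (hc : ContinuousOn f (Icc a b))
    (hd : ∀ t ∈ Ioo a b, HasDerivAt f (f' t) t) (hn : ∀ t ∈ Ioo a b, f' t ≤ 0) :
    AntitoneOn f (Icc a b) := by
  refine antitoneOn_of_deriv_nonpos (convex_Icc a b) hc ?_ ?_
  · intro t ht
    rw [interior_Icc] at ht
    exact (hd t ht).differentiableAt.differentiableWithinAt
  · intro t ht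
    rw [interior_Icc] at ht
    rw [(hd t ht).deriv]
    exact hn t ht

/-- An interpolation inequality for first derivatives: if `f` is bounded by `ε` and `f'` is
Lipschitz with constant `M` on `[t, t + h]`, then `‖f' t‖ ≤ 2 ε / h + M h`. -/
theorem norm_deriv_le_of_lipschitz {f f' : ℝ → H} {t h ε M : ℝ} (hh : 0 < h)
    (hd : ∀ s ∈ Icc t (t + h), HasDerivAt f (f' s) s)
    (hf : ∀ s ∈ Icc t (t + h), ‖f s‖ ≤ ε)
    (hl : ∀ s ∈ Icc t (t + h), ‖f' s - f' t‖ ≤ M * (s - t)) (hM : 0 ≤ M) :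
    ‖f' t‖ ≤ 2 * ε / h + M * h := by
  let _ : NormedSpace ℝ H := NormedSpace.complexToReal
  have ht : t ∈ Icc t (t + h) := ⟨le_rfl, by linarith⟩
  have hth : t + h ∈ Icc t (t + h) := ⟨by linarith, le_rfl⟩
  have key : ‖(f (t + h) - (t + h) • f' t) - (f t - t • f' t)‖ ≤ (M * h) * ‖(t + h) - t‖ := by
    refine (convex_Icc t (t + h)).norm_image_sub_le_of_norm_hasDerivWithin_le
      (f := fun s => f s - s • f' t) (f' := fun s => f' s - (1 : ℝ) • f' t) ?_ ?_ ht hth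
    · intro s hs
      exact ((hd s hs).sub ((hasDerivAt_id s).smul_const (f' t))).hasDerivWithinAt
    · intro s hs
      rw [one_smul]
      exact (hl s hs).trans (mul_le_mul_of_nonneg_left (by linarith [hs.2]) hM)
  have e1 : (f (t + h) - (t + h) • f' t) - (f t - t • f' t) = (f (t + h) - f t) - h • f' t := by
    rw [add_smul]; abel
  rw [e1, add_sub_cancel_left, Real.norm_of_nonneg hh.le] at key
  have e2 : h * ‖f' t‖ ≤ 2 * ε + M * h * h := by
    calc h * ‖f' t‖ = ‖h • f' t‖ := by rw [norm_smul, Real.norm_of_nonneg hh.le]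
      _ = ‖(f (t + h) - f t) - ((f (t + h) - f t) - h • f' t)‖ := by congr 1; abel
      _ ≤ ‖f (t + h)‖ + ‖f t‖ + M * h * h :=
        (norm_sub_le _ _).trans (add_le_add (norm_sub_le _ _) key)
      _ ≤ _ := by linarith [hf t ht, hf _ hth]
  have : ‖f' t‖ ≤ (2 * ε + M * h * h) / h := by rw [le_div_iff₀ hh]; linarith
  refine this.trans (le_of_eq ?_)
  field_simp

theorem re_inner_self_eq (u : H) : (inner ℂ u u).re = ‖u‖ ^ 2 :=
  inner_self_eq_norm_sq (𝕜 := ℂ) u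

variable {S T : H →L[ℂ] H} {a : ℝ}

theorem re_inner_I_smul_self (hT : T.IsSymmetric) (u : H) :
    (inner ℂ u (Complex.I • T u)).re = 0 := by
  have h : (starRingEnd ℂ) (inner ℂ u (T u)) = inner ℂ u (T u) := by
    rw [inner_conj_symm]; exact hT u u
  have him : (inner ℂ u (T u)).im = 0 := Complex.conj_eq_iff_im.1 h
  rw [inner_smul_right]
  simp [him]

/-- The form of a symmetric `T` is real, so `i T` contributes nothing and only `-S²` dissipates. -/
theorem re_inner_generator (hS : S.IsSymmetric) (hT : T.IsSymmetric) (u : H) :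
    (inner ℂ u ((Complex.I • T - S * S) u)).re = -‖S u‖ ^ 2 := by
  have h1 : inner ℂ u (S (S u)) = inner ℂ (S u) (S u) := (hS u (S u)).symm
  have h2 : (inner ℂ u (Complex.I • T u)).re = 0 := re_inner_I_smul_self hT u
  simp only [sub_apply, smul_apply,
    mul_apply_eq_comp, inner_sub_right, Complex.sub_re, h2, h1, re_inner_self_eq]
  simp

variable [CompleteSpace H]

/-- The flow `t ↦ exp (t B)` of a bounded operator. -/
noncomputable def expFlow (B : H →L[ℂ] H) (t : ℝ) : H →L[ℂ] H := NormedSpace.exp (t • B)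

theorem expFlow_zero (B : H →L[ℂ] H) (x : H) : expFlow B 0 x = x := by
  simp [expFlow]

theorem commute_expFlow {B P : H →L[ℂ] H} (h : Commute P B) (t : ℝ) (x : H) :
    P (expFlow B t x) = expFlow B t (P x) := by
  have : Commute P (expFlow B t) := (h.smul_right t).exp_right
  exact congrArg (fun Q : H →L[ℂ] H => Q x) this.eq

theorem expFlow_add (B : H →L[ℂ] H) (s t : ℝ) (x : H) :
    expFlow B (s + t) x = expFlow B s (expFlow B t x) := by
  have : expFlow B (s + t) = expFlow B s * expFlow B t := by
    let _ : NormedAlgebra ℚ (H →L[ℂ] H) := NormedAlgebra.restrictScalars ℚ ℝ _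
    unfold expFlow
    rw [add_smul]
    exact NormedSpace.exp_add_of_commute (((Commute.refl B).smul_left s).smul_right t)
  rw [this]; rfl

theorem hasDerivAt_expFlow (B : H →L[ℂ] H) (x : H) (t : ℝ) :
    HasDerivAt (fun s => expFlow B s x) (B (expFlow B t x)) t := by
  have h : HasDerivAt (fun s : ℝ => NormedSpace.exp (s • B)) (B * NormedSpace.exp (t • B)) t :=
    hasDerivAt_exp_smul_const' B t
  have := ((ContinuousLinearMap.apply ℂ H x).restrictScalars ℝ).hasFDerivAt.comp_hasDerivAt t h
  exact this

theorem continuous_expFlow (B : H →L[ℂ] H) (x : H) : Continuous fun s => expFlow B s x :=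
  continuous_iff_continuousAt.2 fun t => (hasDerivAt_expFlow B x t).continuousAt

theorem hasDerivAt_normSq_expFlow (hS : S.IsSymmetric) (hT : T.IsSymmetric) (x : H) (t : ℝ) :
    HasDerivAt (fun s => ‖expFlow (Complex.I • T - S * S) s x‖ ^ 2)
      (-2 * ‖S (expFlow (Complex.I • T - S * S) t x)‖ ^ 2) t := by
  have := hasDerivAt_normSq (hasDerivAt_expFlow (Complex.I • T - S * S) x t)
  rw [re_inner_generator hS hT] at this
  convert this using 1
  ring

/-- The smoothing estimate `t ‖B exp (t B)‖ ≤ K` for `B = i T - S²`, with `K` depending only on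
the relative bound of `T` with respect to `S`. -/
theorem norm_generator_expFlow_le (hS : S.IsSymmetric) (hT : T.IsSymmetric)
    (hST : ∀ u, ‖T u‖ ≤ a * ‖S u‖) (x : H) {t : ℝ} (ht : 0 ≤ t) :
    t * ‖(Complex.I • T - S * S) (expFlow (Complex.I • T - S * S) t x)‖ ≤
      (2 + 4 * t * a ^ 2) * ‖x‖ := by
  set B := Complex.I • T - S * S with hB
  set u : ℝ → H := fun s => expFlow B s x with hu
  have hu' : ∀ s, HasDerivAt u (B (u s)) s := fun s => hasDerivAt_expFlow B x s
  have hv' : ∀ s, HasDerivAt (fun s => B (u s)) (B (B (u s))) s := fun s =>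
    (B.restrictScalars ℝ).hasFDerivAt.comp_hasDerivAt s (hu' s)
  have hw' : ∀ s, HasDerivAt (fun s => S (u s)) (S (B (u s))) s := fun s =>
    (S.restrictScalars ℝ).hasFDerivAt.comp_hasDerivAt s (hu' s)
  have d0 : ∀ s, HasDerivAt (fun s => ‖u s‖ ^ 2) (-2 * ‖S (u s)‖ ^ 2) s :=
    fun s => hasDerivAt_normSq_expFlow hS hT x s
  have d1 : ∀ s, HasDerivAt (fun s => ‖S (u s)‖ ^ 2)
      (2 * (inner ℂ (S (u s)) (S (B (u s)))).re) s := fun s => hasDerivAt_normSq (hw' s)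
  -- `B u` is again a trajectory of the same flow, so it obeys the same energy identity.
  have d2 : ∀ s, HasDerivAt (fun s => ‖B (u s)‖ ^ 2) (-2 * ‖S (B (u s))‖ ^ 2) s := by
    intro s
    have := hasDerivAt_normSq (hv' s)
    rw [re_inner_generator hS hT] at this
    convert this using 1
    ring
  -- In the functional below, the weight `4 s` cancels the `‖S² u‖²` produced by `2 s ‖B u‖²`. What
  -- remains is at most `(4 + 8 s a²) ‖S u‖²`, and this value of `b` makes `2 b` cover it for all `s
  -- ≤ t`.
  set b : ℝ := 2 + 4 * t * a ^ 2 with hb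
  have hta : 0 ≤ t * a ^ 2 := by positivity
  have bS : ∀ y, 2 * (inner ℂ (S y) (S (B y))).re ≤ -‖S (S y)‖ ^ 2 + a ^ 2 * ‖S y‖ ^ 2 := by
    intro y
    have e1 : inner ℂ (S y) (S (B y)) = inner ℂ (S (S y)) (B y) := (hS (S y) (B y)).symm
    have e2 : (inner ℂ (S (S y)) (B y)).re
        = (inner ℂ (S (S y)) (Complex.I • T y)).re - ‖S (S y)‖ ^ 2 := by
      simp only [hB, sub_apply, smul_apply,
        mul_apply_eq_comp, inner_sub_right, Complex.sub_re]
      rw [re_inner_self_eq]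
    have e3 : (inner ℂ (S (S y)) (Complex.I • T y)).re ≤ ‖S (S y)‖ * (a * ‖S y‖) := by
      refine (Complex.re_le_norm _).trans ((norm_inner_le_norm _ _).trans ?_)
      rw [norm_smul, Complex.norm_I, one_mul]
      exact mul_le_mul_of_nonneg_left (hST y) (norm_nonneg _)
    rw [e1, e2]
    nlinarith [sq_nonneg (‖S (S y)‖ - a * ‖S y‖)]
  have bB : ∀ y, ‖B y‖ ^ 2 ≤ 2 * ‖S (S y)‖ ^ 2 + 2 * a ^ 2 * ‖S y‖ ^ 2 := by
    intro y
    have : ‖B y‖ ≤ a * ‖S y‖ + ‖S (S y)‖ := by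
      calc ‖B y‖ = ‖Complex.I • T y - S (S y)‖ := rfl
        _ ≤ ‖Complex.I • T y‖ + ‖S (S y)‖ := norm_sub_le _ _
        _ ≤ _ := by
          rw [norm_smul, Complex.norm_I, one_mul]
          exact add_le_add_left (hST y) _
    nlinarith [norm_nonneg (B y), sq_nonneg (‖S (S y)‖ - a * ‖S y‖)]
  have hanti : AntitoneOn
      (fun s => s ^ 2 * ‖B (u s)‖ ^ 2 + 4 * s * ‖S (u s)‖ ^ 2 + b * ‖u s‖ ^ 2) (Icc 0 t) := by
    have hd : ∀ s, HasDerivAt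
        (fun s => s ^ 2 * ‖B (u s)‖ ^ 2 + 4 * s * ‖S (u s)‖ ^ 2 + b * ‖u s‖ ^ 2)
        ((2 * s * ‖B (u s)‖ ^ 2 + s ^ 2 * (-2 * ‖S (B (u s))‖ ^ 2)) +
          (4 * ‖S (u s)‖ ^ 2 + 4 * s * (2 * (inner ℂ (S (u s)) (S (B (u s)))).re)) +
          b * (-2 * ‖S (u s)‖ ^ 2)) s := by
      intro s
      have p2 : HasDerivAt (fun s : ℝ => s ^ 2) (2 * s) s := by simpa using hasDerivAt_pow 2 s
      have p1 : HasDerivAt (fun s : ℝ => 4 * s) 4 s := by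
        simpa using (hasDerivAt_id s).const_mul 4
      exact ((p2.mul (d2 s)).add (p1.mul (d1 s))).add ((d0 s).const_mul b)
    refine antitoneOn_Icc_of_hasDerivAt (fun s _ => (hd s).continuousAt.continuousWithinAt)
      (fun s _ => hd s) ?_
    intro s hs
    have h1 := mul_le_mul_of_nonneg_left (bB (u s)) (show 0 ≤ 2 * s by linarith [hs.1])
    have h2 := mul_le_mul_of_nonneg_left (bS (u s)) (show 0 ≤ 4 * s by linarith [hs.1])
    have h3 : s * a ^ 2 * ‖S (u s)‖ ^ 2 ≤ t * a ^ 2 * ‖S (u s)‖ ^ 2 := by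
      have := hs.2.le; gcongr
    have h4 : 0 ≤ s ^ 2 * ‖S (B (u s))‖ ^ 2 := by positivity
    rw [hb]
    nlinarith
  have hfin := hanti ⟨le_rfl, ht⟩ ⟨ht, le_rfl⟩ ht
  have hu0 : u 0 = x := expFlow_zero B x
  simp only [hu0] at hfin
  have h5 : 0 ≤ 4 * t * ‖S (u t)‖ ^ 2 := by positivity
  have hb2 : 2 ≤ b := by rw [hb]; nlinarith
  have h6 : 0 ≤ b * ‖u t‖ ^ 2 := by positivity
  refine le_of_sq_le_sq ?_ (by positivity)
  -- Monotonicity yields `t² ‖B u‖² ≤ b ‖x‖²`; as `b ≥ 1`, the square root of `b` may be replaced by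
  -- `b`.
  have h7 : b * ‖x‖ ^ 2 ≤ b ^ 2 * ‖x‖ ^ 2 := by
    have := sq_nonneg ‖x‖
    nlinarith [mul_nonneg (mul_nonneg (by linarith : 0 ≤ b) (by linarith : 0 ≤ b - 1)) this]
  nlinarith

end Flow

/-! ### Truncated diagonal operators in the eigenbasis. -/

section Truncation

variable {H : Type*} [NormedAddCommGroup H] [InnerProductSpace ℂ H]

theorem ext_inner_basis (e : HilbertBasis ℕ ℂ H) {x y : H}
    (h : ∀ j, inner ℂ (e j) x = inner ℂ (e j) y) : x = y := by
  apply e.repr.injective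
  ext j
  rw [e.repr_apply_apply, e.repr_apply_apply, h]

theorem hasSum_normSq_inner (e : HilbertBasis ℕ ℂ H) (x : H) :
    HasSum (fun j => ‖inner ℂ (e j) x‖ ^ 2) (‖x‖ ^ 2) := by
  have h := Complex.hasSum_re (e.hasSum_inner_mul_inner x x)
  rw [re_inner_self_eq] at h
  convert h using 2 with j
  rw [← inner_conj_symm x (e j), ← Complex.normSq_eq_conj_mul_self, Complex.ofReal_re,
    Complex.normSq_eq_norm_sq]

theorem sum_normSq_inner_le (e : HilbertBasis ℕ ℂ H) (x : H) (s : Finset ℕ) :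
    ∑ j ∈ s, ‖inner ℂ (e j) x‖ ^ 2 ≤ ‖x‖ ^ 2 :=
  sum_le_hasSum s (fun _ _ => by positivity) (hasSum_normSq_inner e x)

/-- The truncated diagonal operator `u ↦ ∑ j < N, f j ⟨e j, u⟩ e j`. -/
noncomputable def diagTrunc (e : HilbertBasis ℕ ℂ H) (f : ℕ → ℝ) (N : ℕ) : H →L[ℂ] H :=
  ∑ j ∈ Finset.range N, (f j : ℂ) • (innerSL ℂ (e j)).smulRight (e j)

variable (e : HilbertBasis ℕ ℂ H) (f g : ℕ → ℝ)

theorem diagTrunc_apply (N : ℕ) (u : H) :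
    diagTrunc e f N u = ∑ j ∈ Finset.range N, (f j : ℂ) • inner ℂ (e j) u • e j := by
  simp [diagTrunc]

theorem inner_basis_sum (N : ℕ) (c : ℕ → ℂ) (k : ℕ) :
    inner ℂ (e k) (∑ j ∈ Finset.range N, c j • e j) = if k < N then c k else 0 := by
  simp only [inner_sum, inner_smul_right, orthonormal_iff_ite.1 e.orthonormal]
  simp

theorem inner_diagTrunc (N : ℕ) (u : H) (k : ℕ) :
    inner ℂ (e k) (diagTrunc e f N u) = if k < N then (f k : ℂ) * inner ℂ (e k) u else 0 := by
  simp only [diagTrunc_apply, smul_smul]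
  exact inner_basis_sum e N _ k

theorem diagTrunc_isSymmetric (N : ℕ) : (diagTrunc e f N).IsSymmetric := by
  intro x y
  simp only [ContinuousLinearMap.coe_coe, diagTrunc_apply, sum_inner, inner_sum, inner_smul_left,
    inner_smul_right, Complex.conj_ofReal, inner_conj_symm]
  exact Finset.sum_congr rfl fun j _ => by ring

theorem diagTrunc_mul (N M : ℕ) :
    diagTrunc e f N * diagTrunc e g M = diagTrunc e (f * g) (min N M) := by
  ext u
  refine ext_inner_basis e fun k => ?_
  rw [mul_apply_eq_comp, inner_diagTrunc, inner_diagTrunc, inner_diagTrunc]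
  by_cases h1 : k < N <;> by_cases h2 : k < M <;> simp [h1, h2, mul_assoc]

theorem normSq_diagTrunc (N : ℕ) (u : H) :
    ‖diagTrunc e f N u‖ ^ 2 = ∑ j ∈ Finset.range N, f j ^ 2 * ‖inner ℂ (e j) u‖ ^ 2 := by
  refine (hasSum_normSq_inner e _).unique ?_
  have : ∀ j, ‖inner ℂ (e j) (diagTrunc e f N u)‖ ^ 2
      = if j ∈ Finset.range N then f j ^ 2 * ‖inner ℂ (e j) u‖ ^ 2 else 0 := by
    intro j
    rw [inner_diagTrunc]
    by_cases h : j < N <;> simp [h, mul_pow]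
  simp only [this]
  rw [← Finset.sum_congr rfl fun j hj => if_pos hj]
  exact hasSum_sum_of_ne_finset_zero fun j hj => if_neg hj

theorem norm_diagTrunc_one_le (N : ℕ) (u : H) : ‖diagTrunc e 1 N u‖ ≤ ‖u‖ := by
  refine le_of_sq_le_sq ?_ (norm_nonneg _)
  rw [normSq_diagTrunc]
  simpa using sum_normSq_inner_le e u _

theorem tendsto_diagTrunc_one (u : H) : Tendsto (fun N => diagTrunc e 1 N u) atTop (𝓝 u) := by
  have := (e.hasSum_repr u).tendsto_sum_nat
  simpa only [diagTrunc_apply, Pi.one_apply, Complex.ofReal_one, one_smul, e.repr_apply_apply]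
    using this

theorem diagTrunc_one_diagTrunc_one (N M : ℕ) (u : H) :
    diagTrunc e 1 N (diagTrunc e 1 M u) = diagTrunc e 1 (min N M) u := by
  have := congrArg (fun Q : H →L[ℂ] H => Q u) (diagTrunc_mul e 1 1 N M)
  rwa [mul_one] at this

theorem inner_eq_zero_of_diagTrunc_one_eq {N : ℕ} {u : H} (hu : diagTrunc e 1 N u = u) {k : ℕ}
    (hk : N ≤ k) : inner ℂ (e k) u = 0 := by
  rw [← hu, inner_diagTrunc, if_neg (not_lt.2 hk)]

end Truncation

/-! ### Galerkin generators and the comparison of two truncation levels. -/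

section Galerkin

variable {H : Type*} [NormedAddCommGroup H] [InnerProductSpace ℂ H]

/-- The truncation `u ↦ ∑ j < N, ⟨e j, u⟩ ℓ j` of the operator mapping `e j` to `ℓ j`. -/
noncomputable def truncOp (e : HilbertBasis ℕ ℂ H) (ℓ : ℕ → H) (N : ℕ) : H →L[ℂ] H :=
  ∑ j ∈ Finset.range N, (innerSL ℂ (e j)).smulRight (ℓ j)

/-- `ℓ j = L (e j)` for an operator `L` that is symmetric and bounded by `a` relative to the
square root of the diagonal operator with eigenvalues `lam j`. -/
structure IsRelBounded (e : HilbertBasis ℕ ℂ H) (lam : ℕ → ℝ) (ℓ : ℕ → H) (a : ℝ) : Prop where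
  symm : ∀ i j, inner ℂ (ℓ i) (e j) = inner ℂ (e i) (ℓ j)
  bound : ∀ N u, ‖truncOp e ℓ N u‖ ≤ a * ‖diagTrunc e (fun j => Real.sqrt (lam j)) N u‖

variable (e : HilbertBasis ℕ ℂ H) (lam : ℕ → ℝ) (ℓ : ℕ → H)

theorem truncOp_apply (N : ℕ) (u : H) :
    truncOp e ℓ N u = ∑ j ∈ Finset.range N, inner ℂ (e j) u • ℓ j := by
  simp [truncOp]

/-- The truncated square root of the diagonal operator with eigenvalues `lam j`. -/
noncomputable def sqrtTrunc (N : ℕ) : H →L[ℂ] H := diagTrunc e (fun j => Real.sqrt (lam j)) N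

/-- The compression of the operator `e j ↦ ℓ j` to the span of `e 0, …, e (N - 1)`. -/
noncomputable def compression (N : ℕ) : H →L[ℂ] H := diagTrunc e 1 N * truncOp e ℓ N

/-- The generator of the Galerkin approximation. -/
noncomputable def galerkinOp (N : ℕ) : H →L[ℂ] H :=
  Complex.I • compression e ℓ N - sqrtTrunc e lam N * sqrtTrunc e lam N

variable {e lam ℓ} {a : ℝ}

theorem sqrtTrunc_mul_self (hlam : ∀ j, 0 < lam j) (N : ℕ) :
    sqrtTrunc e lam N * sqrtTrunc e lam N = diagTrunc e lam N := by
  rw [sqrtTrunc, diagTrunc_mul, min_self]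
  congr 1
  ext j
  exact Real.mul_self_sqrt (hlam j).le

theorem normSq_sqrtTrunc (hlam : ∀ j, 0 < lam j) (N : ℕ) (u : H) :
    ‖sqrtTrunc e lam N u‖ ^ 2 = ∑ j ∈ Finset.range N, lam j * ‖inner ℂ (e j) u‖ ^ 2 := by
  rw [sqrtTrunc, normSq_diagTrunc]
  exact Finset.sum_congr rfl fun j _ => by rw [Real.sq_sqrt (hlam j).le]

theorem sqrtTrunc_isSymmetric (N : ℕ) : (sqrtTrunc e lam N).IsSymmetric :=
  diagTrunc_isSymmetric e _ N

theorem compression_isSymmetric (h : IsRelBounded e lam ℓ a) (N : ℕ) :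
    (compression e ℓ N).IsSymmetric := by
  intro x y
  have h1 : inner ℂ (compression e ℓ N x) y = inner ℂ (truncOp e ℓ N x) (diagTrunc e 1 N y) :=
    diagTrunc_isSymmetric e 1 N _ _
  have h2 : inner ℂ x (compression e ℓ N y) = inner ℂ (diagTrunc e 1 N x) (truncOp e ℓ N y) :=
    (diagTrunc_isSymmetric e 1 N _ _).symm
  rw [ContinuousLinearMap.coe_coe, h1, h2]
  simp only [truncOp_apply, diagTrunc_apply, sum_inner, inner_sum, inner_smul_left,
    inner_smul_right, h.symm]
  simp

theorem norm_compression_le (h : IsRelBounded e lam ℓ a) (N : ℕ) (u : H) :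
    ‖compression e ℓ N u‖ ≤ a * ‖sqrtTrunc e lam N u‖ :=
  (norm_diagTrunc_one_le e N _).trans (h.bound N u)

/-- Keeps Galerkin trajectories inside the span of the first `N` basis vectors. -/
theorem commute_galerkinOp (N : ℕ) :
    Commute (diagTrunc e 1 N) (galerkinOp e lam ℓ N) := by
  have h1 : diagTrunc e 1 N * diagTrunc e 1 N = diagTrunc e 1 N := by
    rw [diagTrunc_mul, min_self, mul_one]
  have h2 : truncOp e ℓ N * diagTrunc e 1 N = truncOp e ℓ N := by
    ext u
    simp only [mul_apply_eq_comp, truncOp_apply, inner_diagTrunc]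
    refine Finset.sum_congr rfl fun j hj => ?_
    simp [Finset.mem_range.1 hj]
  have h3 : Commute (diagTrunc e 1 N) (sqrtTrunc e lam N) := by
    rw [Commute, SemiconjBy, sqrtTrunc, diagTrunc_mul, diagTrunc_mul, mul_comm]
  have h4 : Commute (diagTrunc e 1 N) (compression e ℓ N) := by
    rw [Commute, SemiconjBy, compression, mul_assoc, h2, ← mul_assoc, h1]
  exact (h4.smul_right _).sub_right (h3.mul_right h3)

/-- On the smaller span both levels have the same diagonal part; they differ only by the components
of `truncOp e ℓ N u` in modes `N ≤ k < M`. -/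
theorem galerkinOp_apply_of_le {N M : ℕ} (hNM : N ≤ M) {u : H} (hu : diagTrunc e 1 N u = u) :
    galerkinOp e lam ℓ M u = galerkinOp e lam ℓ N u +
      Complex.I • (diagTrunc e 1 M - diagTrunc e 1 N) (truncOp e ℓ N u) := by
  have h1 : truncOp e ℓ M u = truncOp e ℓ N u := by
    rw [truncOp_apply, truncOp_apply]
    refine (Finset.sum_subset (Finset.range_mono hNM) fun j _ hj => ?_).symm
    rw [inner_eq_zero_of_diagTrunc_one_eq e hu (by simpa using hj), zero_smul]
  have h2 : (sqrtTrunc e lam M * sqrtTrunc e lam M) u =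
      (sqrtTrunc e lam N * sqrtTrunc e lam N) u := by
    rw [sqrtTrunc, sqrtTrunc, diagTrunc_mul, diagTrunc_mul, min_self, min_self]
    refine ext_inner_basis e fun k => ?_
    rw [inner_diagTrunc, inner_diagTrunc]
    by_cases hk : k < N
    · rw [if_pos hk, if_pos (hk.trans_le hNM)]
    · rw [inner_eq_zero_of_diagTrunc_one_eq e hu (not_lt.1 hk)]; simp
  simp only [galerkinOp, sub_apply, smul_apply, h2, compression, mul_apply_eq_comp, h1, smul_sub]
  abel

theorem normSq_diagTrunc_sub_le (hlam : ∀ j, 0 < lam j) (hmono : Monotone lam) {N M : ℕ}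
    (hNM : N ≤ M) (u : H) :
    lam N * ‖(diagTrunc e 1 M - diagTrunc e 1 N) u‖ ^ 2 ≤ ‖sqrtTrunc e lam M u‖ ^ 2 := by
  have h1 : ‖(diagTrunc e 1 M - diagTrunc e 1 N) u‖ ^ 2 =
      ∑ j ∈ Finset.Ico N M, ‖inner ℂ (e j) u‖ ^ 2 := by
    refine (hasSum_normSq_inner e _).unique ?_
    have : ∀ j, ‖inner ℂ (e j) ((diagTrunc e 1 M - diagTrunc e 1 N) u)‖ ^ 2
        = if j ∈ Finset.Ico N M then ‖inner ℂ (e j) u‖ ^ 2 else 0 := by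
      intro j
      rw [sub_apply, inner_sub_right, inner_diagTrunc, inner_diagTrunc]
      by_cases h1 : j < N
      · simp [h1, h1.trans_le hNM]
      · by_cases h2 : j < M <;> simp [h1, h2, not_lt.1 h1]
    simp only [this]
    rw [← Finset.sum_congr rfl fun j hj => if_pos hj]
    exact hasSum_sum_of_ne_finset_zero fun j hj => if_neg hj
  rw [h1, normSq_sqrtTrunc hlam, Finset.mul_sum]
  calc _ ≤ ∑ j ∈ Finset.Ico N M, lam j * ‖inner ℂ (e j) u‖ ^ 2 :=
        Finset.sum_le_sum fun j hj =>
          mul_le_mul_of_nonneg_right (hmono (Finset.mem_Ico.1 hj).1) (by positivity)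
    _ ≤ _ := Finset.sum_le_sum_of_subset_of_nonneg
        (fun j hj => Finset.mem_range.2 (Finset.mem_Ico.1 hj).2)
        fun j _ _ => mul_nonneg (hlam j).le (by positivity)

variable [CompleteSpace H]

/-- The residual pairs only with the modes of `w` between `N` and `M`, where the dissipation of `w`
is at least `lam N` times the mass. Absorbing it leaves `a² ‖S u‖² / lam N`, whose time integral is
paid for by the decay of `‖u‖²`. -/
theorem normSq_expFlow_sub_le (hlam : ∀ j, 0 < lam j) (hmono : Monotone lam)
    (h : IsRelBounded e lam ℓ a) {N M : ℕ} (hNM : N ≤ M) {x : H} (hx : diagTrunc e 1 N x = x)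
    (y : H) {t : ℝ} (ht : 0 ≤ t) :
    ‖expFlow (galerkinOp e lam ℓ M) t y - expFlow (galerkinOp e lam ℓ N) t x‖ ^ 2 ≤
      ‖y - x‖ ^ 2 + a ^ 2 / lam N * ‖x‖ ^ 2 := by
  set u : ℝ → H := fun s => expFlow (galerkinOp e lam ℓ N) s x with hu
  set w : ℝ → H := fun s => expFlow (galerkinOp e lam ℓ M) s y - u s with hw
  have hPu : ∀ s, diagTrunc e 1 N (u s) = u s := fun s => by
    rw [hu]; simp only; rw [commute_expFlow (commute_galerkinOp N), hx]
  set r : ℝ → H :=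
    fun s => Complex.I • (diagTrunc e 1 M - diagTrunc e 1 N) (truncOp e ℓ N (u s)) with hr
  have du : ∀ s, HasDerivAt (fun s => ‖u s‖ ^ 2) (-2 * ‖sqrtTrunc e lam N (u s)‖ ^ 2) s :=
    fun s => hasDerivAt_normSq_expFlow (sqrtTrunc_isSymmetric N)
      (compression_isSymmetric h N) x s
  have dw : ∀ s, HasDerivAt w (galerkinOp e lam ℓ M (w s) + r s) s := by
    intro s
    have : HasDerivAt w _ s := (hasDerivAt_expFlow (galerkinOp e lam ℓ M) y s).sub
      (hasDerivAt_expFlow (galerkinOp e lam ℓ N) x s)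
    refine this.congr_deriv ?_
    have hws : w s = expFlow (galerkinOp e lam ℓ M) s y - u s := rfl
    have hrs : r s = Complex.I • (diagTrunc e 1 M - diagTrunc e 1 N) (truncOp e ℓ N (u s)) := rfl
    rw [hws, hrs, map_sub, galerkinOp_apply_of_le hNM (hPu s)]
    abel
  have dw2 : ∀ s, HasDerivAt (fun s => ‖w s‖ ^ 2)
      (-2 * ‖sqrtTrunc e lam M (w s)‖ ^ 2 + 2 * (inner ℂ (w s) (r s)).re) s := by
    intro s
    have := hasDerivAt_normSq (dw s)
    rw [inner_add_right, Complex.add_re, galerkinOp,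
      re_inner_generator (sqrtTrunc_isSymmetric M) (compression_isSymmetric h M)] at this
    convert this using 1
    ring
  have br : ∀ s, (inner ℂ (w s) (r s)).re ≤
      ‖(diagTrunc e 1 M - diagTrunc e 1 N) (w s)‖ * (a * ‖sqrtTrunc e lam N (u s)‖) := by
    intro s
    have e1 : inner ℂ (w s) ((diagTrunc e 1 M - diagTrunc e 1 N) (truncOp e ℓ N (u s))) =
        inner ℂ ((diagTrunc e 1 M - diagTrunc e 1 N) (w s)) (truncOp e ℓ N (u s)) := by
      simp only [sub_apply, inner_sub_left, inner_sub_right]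
      have k1 := diagTrunc_isSymmetric e 1 M (w s) (truncOp e ℓ N (u s))
      have k2 := diagTrunc_isSymmetric e 1 N (w s) (truncOp e ℓ N (u s))
      simp only [ContinuousLinearMap.coe_coe] at k1 k2
      rw [k1, k2]
    refine (Complex.re_le_norm _).trans ?_
    rw [hr]
    simp only
    rw [inner_smul_right, norm_mul, Complex.norm_I, one_mul, e1]
    exact (norm_inner_le_norm _ _).trans (mul_le_mul_of_nonneg_left (h.bound N _) (norm_nonneg _))
  have hE := antitoneOn_Ici_of_hasDerivAt (a := 0)
    (f := fun s => ‖w s‖ ^ 2 + a ^ 2 / lam N * ‖u s‖ ^ 2)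
    (fun s _ => ((dw2 s).add ((du s).const_mul (a ^ 2 / lam N))).continuousAt.continuousWithinAt)
    (fun s _ => (dw2 s).add ((du s).const_mul (a ^ 2 / lam N))) ?_
    (mem_Ici.2 le_rfl) (mem_Ici.2 ht) ht
  · simp only [hw, hu, expFlow_zero] at hE
    have : 0 ≤ a ^ 2 / lam N * ‖expFlow (galerkinOp e lam ℓ N) t x‖ ^ 2 := by
      have := hlam N; positivity
    linarith
  · intro s _
    set p := ‖(diagTrunc e 1 M - diagTrunc e 1 N) (w s)‖
    set q := a * ‖sqrtTrunc e lam N (u s)‖ with hq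
    have h1 : lam N * p ^ 2 ≤ ‖sqrtTrunc e lam M (w s)‖ ^ 2 :=
      normSq_diagTrunc_sub_le hlam hmono hNM (w s)
    -- Young's inequality with weight `lam N`, so that the first term fits under the dissipation
    -- `h1`.
    have h2 : 2 * (p * q) ≤ lam N * p ^ 2 + q ^ 2 / lam N := by
      have hl := hlam N
      have : lam N * p ^ 2 + q ^ 2 / lam N - 2 * (p * q) = (lam N * p - q) ^ 2 / lam N := by
        field_simp; ring
      have h3 : 0 ≤ (lam N * p - q) ^ 2 / lam N := by positivity
      linarith
    have h3 : a ^ 2 / lam N * (-2 * ‖sqrtTrunc e lam N (u s)‖ ^ 2) = -2 * (q ^ 2 / lam N) := by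
      rw [hq]; ring
    have h4 : 0 ≤ q ^ 2 / lam N := by have := hlam N; positivity
    rw [h3]
    have h5 := br s
    have h6 := sq_nonneg ‖sqrtTrunc e lam M (w s)‖
    linarith

end Galerkin

/-! ### Passage to the limit in the Galerkin scheme. -/

section Limit

variable {H : Type*} [NormedAddCommGroup H] [InnerProductSpace ℂ H]
  {e : HilbertBasis ℕ ℂ H} {lam : ℕ → ℝ} {ℓ : ℕ → H} {a : ℝ}

/-- Limits of truncated vectors along which the Galerkin generators converge have finite
`H^2`-norm, and the limit of the generators is given by the weak form of the equation. -/
theorem limit_galerkinOp (hlam : ∀ j, 0 < lam j) (h : IsRelBounded e lam ℓ a)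
    {x : ℕ → H} {y z : H} (hx : ∀ N, diagTrunc e 1 N (x N) = x N)
    (hy : Tendsto x atTop (𝓝 y))
    (hz : Tendsto (fun N => galerkinOp e lam ℓ N (x N)) atTop (𝓝 z)) :
    (Summable fun j => lam j ^ 2 * ‖inner ℂ (e j) y‖ ^ 2) ∧
      ∀ j, inner ℂ (e j) z = Complex.I * inner ℂ (ℓ j) y - lam j * inner ℂ (e j) y := by
  have hcoef : ∀ j, Tendsto (fun N => inner ℂ (e j) (x N)) atTop (𝓝 (inner ℂ (e j) y)) :=
    fun j => tendsto_const_nhds.inner hy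
  constructor
  · obtain ⟨R1, hR1⟩ := hy.norm.bddAbove_range
    obtain ⟨R2, hR2⟩ := hz.norm.bddAbove_range
    have hR1' : ∀ N, ‖x N‖ ≤ R1 := fun N => hR1 ⟨N, rfl⟩
    have hR2' : ∀ N, ‖galerkinOp e lam ℓ N (x N)‖ ≤ R2 := fun N => hR2 ⟨N, rfl⟩
    -- With `G = ‖Γ_N x_N‖` and `s = ‖Γ_N^{1/2} x_N‖` one has `s² ≤ R1 G` and `G ≤ R2 + a s`; since
    -- `a s ≤ a² R1 / 2 + G / 2`, this closes to `G ≤ R`.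
    set R := 2 * R2 + a ^ 2 * R1 with hR
    have hbound : ∀ N, ‖diagTrunc e lam N (x N)‖ ≤ R := by
      intro N
      set G := ‖diagTrunc e lam N (x N)‖
      have e1 : ‖sqrtTrunc e lam N (x N)‖ ^ 2 ≤ ‖x N‖ * G := by
        have : inner ℂ (x N) (diagTrunc e lam N (x N)) =
            inner ℂ (sqrtTrunc e lam N (x N)) (sqrtTrunc e lam N (x N)) := by
          rw [← sqrtTrunc_mul_self hlam]
          exact (sqrtTrunc_isSymmetric N _ _).symm
        rw [← re_inner_self_eq, ← this]
        exact (Complex.re_le_norm _).trans (norm_inner_le_norm _ _)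
      have e2 : G ≤ R2 + a * ‖sqrtTrunc e lam N (x N)‖ := by
        have : diagTrunc e lam N (x N) =
            Complex.I • compression e ℓ N (x N) - galerkinOp e lam ℓ N (x N) := by
          rw [galerkinOp, sqrtTrunc_mul_self hlam]
          simp only [sub_apply, smul_apply, sub_sub_cancel]
        calc G = ‖Complex.I • compression e ℓ N (x N) - galerkinOp e lam ℓ N (x N)‖ := by
              rw [← this]
          _ ≤ ‖Complex.I • compression e ℓ N (x N)‖ + ‖galerkinOp e lam ℓ N (x N)‖ :=
              norm_sub_le _ _
          _ ≤ a * ‖sqrtTrunc e lam N (x N)‖ + R2 := by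
              rw [norm_smul, Complex.norm_I, one_mul]
              exact add_le_add (norm_compression_le h N _) (hR2' N)
          _ = _ := add_comm _ _
      have hG : 0 ≤ G := norm_nonneg _
      have e3 : ‖x N‖ * G ≤ R1 * G := mul_le_mul_of_nonneg_right (hR1' N) hG
      set s := ‖sqrtTrunc e lam N (x N)‖
      have hs : 0 ≤ s := norm_nonneg _
      have hR1n : 0 ≤ R1 := (norm_nonneg _).trans (hR1' N)
      -- The Young step divides by `R1`, hence the separate case `R1 = 0`.
      rcases hR1n.eq_or_lt with h0 | h0
      · have : s = 0 := by nlinarith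
        rw [this] at e2
        nlinarith
      · have : a * s ≤ a ^ 2 * R1 / 2 + s ^ 2 / (2 * R1) := by
          have e4 : a ^ 2 * R1 / 2 + s ^ 2 / (2 * R1) - a * s = (a * R1 - s) ^ 2 / (2 * R1) := by
            field_simp; ring
          have : 0 ≤ (a * R1 - s) ^ 2 / (2 * R1) := by positivity
          linarith
        have e5 : s ^ 2 / (2 * R1) ≤ G / 2 := by
          rw [div_le_div_iff₀ (by positivity) (by positivity)]
          linarith
        linarith
    refine summable_of_sum_range_le (c := R ^ 2) (fun j => by positivity) fun J => ?_
    have hlim : Tendsto (fun N => ∑ j ∈ Finset.range J, lam j ^ 2 * ‖inner ℂ (e j) (x N)‖ ^ 2) atTop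
        (𝓝 (∑ j ∈ Finset.range J, lam j ^ 2 * ‖inner ℂ (e j) y‖ ^ 2)) :=
      tendsto_finsetSum _ fun j _ => ((hcoef j).norm.pow 2).const_mul _
    refine le_of_tendsto hlim ((eventually_ge_atTop J).mono fun N hN => ?_)
    calc _ ≤ ∑ j ∈ Finset.range N, lam j ^ 2 * ‖inner ℂ (e j) (x N)‖ ^ 2 :=
          Finset.sum_le_sum_of_subset_of_nonneg (Finset.range_mono hN)
            fun j _ _ => by positivity
      _ = ‖diagTrunc e lam N (x N)‖ ^ 2 := (normSq_diagTrunc e lam N _).symm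
      _ ≤ R ^ 2 := pow_le_pow_left₀ (norm_nonneg _) (hbound N) 2
  · intro j
    have h1 : Tendsto (fun N => inner ℂ (e j) (galerkinOp e lam ℓ N (x N))) atTop
        (𝓝 (inner ℂ (e j) z)) := tendsto_const_nhds.inner hz
    have h2 : Tendsto (fun N => Complex.I * inner ℂ (ℓ j) (x N) - lam j * inner ℂ (e j) (x N)) atTop
        (𝓝 (Complex.I * inner ℂ (ℓ j) y - lam j * inner ℂ (e j) y)) :=
      ((tendsto_const_nhds.inner hy).const_mul _).sub ((hcoef j).const_mul _)
    refine tendsto_nhds_unique h1 (h2.congr' ((eventually_gt_atTop j).mono fun N hN => ?_))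
    -- `x N` is a finite combination of basis vectors, so symmetry on the basis suffices.
    have e1 : inner ℂ (ℓ j) (x N) = inner ℂ (e j) (truncOp e ℓ N (x N)) := by
      conv_lhs => rw [← hx N]
      simp only [diagTrunc_apply, truncOp_apply, inner_sum, inner_smul_right, h.symm]
      simp
    beta_reduce
    rw [galerkinOp, sqrtTrunc_mul_self hlam, sub_apply, smul_apply, inner_sub_right,
      inner_smul_right, compression, mul_apply_eq_comp, inner_diagTrunc, inner_diagTrunc,
      if_pos hN, if_pos hN, e1]
    simp

variable [CompleteSpace H]

/-- The Galerkin approximations are uniformly Cauchy on `[0, ∞)`. -/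
theorem exists_norm_galerkin_sub_le (hlam : ∀ j, 0 < lam j) (hmono : Monotone lam)
    (htends : Tendsto lam atTop atTop) (h : IsRelBounded e lam ℓ a) (x : H) {ε : ℝ} (hε : 0 < ε) :
    ∃ N₀, ∀ N ≥ N₀, ∀ M ≥ N₀, ∀ t : ℝ, 0 ≤ t →
      ‖expFlow (galerkinOp e lam ℓ M) t (diagTrunc e 1 M x) -
        expFlow (galerkinOp e lam ℓ N) t (diagTrunc e 1 N x)‖ ≤ ε := by
  have h1 : Tendsto (fun N => a ^ 2 / lam N * ‖x‖ ^ 2) atTop (𝓝 0) := by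
    simpa using (htends.const_div_atTop (a ^ 2)).mul_const (‖x‖ ^ 2)
  have h2 := (tendsto_diagTrunc_one e x).cauchySeq
  obtain ⟨N1, hN1⟩ := Metric.cauchySeq_iff.1 h2 (ε / 2) (by positivity)
  -- The two contributions `(ε / 2)²` and `ε² / 2` add up to less than `ε²`.
  obtain ⟨N2, hN2⟩ := eventually_atTop.1 (h1.eventually (gt_mem_nhds (show 0 < ε ^ 2 / 2 by positivity)))
  have key : ∀ N ≥ max N1 N2, ∀ M ≥ N, ∀ t : ℝ, 0 ≤ t →
      ‖expFlow (galerkinOp e lam ℓ M) t (diagTrunc e 1 M x) -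
        expFlow (galerkinOp e lam ℓ N) t (diagTrunc e 1 N x)‖ ≤ ε := by
    intro N hN M hM t ht
    have hP : diagTrunc e 1 N (diagTrunc e 1 N x) = diagTrunc e 1 N x := by
      rw [diagTrunc_one_diagTrunc_one, min_self]
    have k1 := normSq_expFlow_sub_le hlam hmono h hM hP (diagTrunc e 1 M x) ht
    have k2 := hN1 M ((le_max_left _ _).trans (hN.trans hM)) N ((le_max_left _ _).trans hN)
    have k3 := hN2 N ((le_max_right _ _).trans hN)
    rw [dist_eq_norm] at k2
    have k4 : a ^ 2 / lam N * ‖diagTrunc e 1 N x‖ ^ 2 ≤ a ^ 2 / lam N * ‖x‖ ^ 2 := by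
      have := hlam N
      have := norm_diagTrunc_one_le e N x
      gcongr
    refine le_of_sq_le_sq ?_ hε.le
    nlinarith [norm_nonneg (diagTrunc e 1 M x - diagTrunc e 1 N x)]
  refine ⟨max N1 N2, fun N hN M hM t ht => ?_⟩
  rcases le_total N M with hNM | hNM
  · exact key N hN M hNM t ht
  · rw [norm_sub_rev]
    exact key M hM N hNM t ht

/-- The time derivatives of the Galerkin approximations are uniformly Cauchy on `[t₁, ∞)`. -/
theorem exists_norm_galerkin_deriv_sub_le (hlam : ∀ j, 0 < lam j) (hmono : Monotone lam)
    (htends : Tendsto lam atTop atTop) (h : IsRelBounded e lam ℓ a) (x : H) {ε t₁ : ℝ}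
    (hε : 0 < ε) (ht₁ : 0 < t₁) :
    ∃ N₀, ∀ N ≥ N₀, ∀ M ≥ N₀, ∀ t : ℝ, t₁ ≤ t →
      ‖galerkinOp e lam ℓ M (expFlow (galerkinOp e lam ℓ M) t (diagTrunc e 1 M x)) -
        galerkinOp e lam ℓ N (expFlow (galerkinOp e lam ℓ N) t (diagTrunc e 1 N x))‖ ≤ ε := by
  set B := galerkinOp e lam ℓ with hB
  set φ : ℕ → ℝ → H := fun N t => expFlow (B N) t (diagTrunc e 1 N x) with hφ
  -- The smoothing constant `2 / s + 4 a²` at its worst, `s = t₁ / 2`.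
  set K := 4 / t₁ + 4 * a ^ 2 with hK
  have hK0 : 0 < K := by positivity
  have smooth : ∀ N (y : H) (s : ℝ), t₁ / 2 ≤ s → ‖B N (expFlow (B N) s y)‖ ≤ K * ‖y‖ := by
    intro N y s hs
    have hs0 : 0 < s := by linarith
    have k1 := norm_generator_expFlow_le (sqrtTrunc_isSymmetric N) (compression_isSymmetric h N)
      (norm_compression_le h N) y hs0.le
    have k2 : 2 / s ≤ 4 / t₁ := by
      rw [div_le_div_iff₀ hs0 ht₁]; linarith
    have k3 : ‖B N (expFlow (B N) s y)‖ ≤ (2 + 4 * s * a ^ 2) * ‖y‖ / s := by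
      rw [le_div_iff₀ hs0, mul_comm]; exact k1
    refine k3.trans ?_
    have k4 : (2 + 4 * s * a ^ 2) * ‖y‖ / s = (2 / s + 4 * a ^ 2) * ‖y‖ := by
      field_simp
    rw [k4, hK]
    gcongr
  have second : ∀ N (s : ℝ), t₁ ≤ s → ‖B N (B N (φ N s))‖ ≤ K ^ 2 * ‖x‖ := by
    intro N s hs
    -- Half of the elapsed time is spent on each application of `B`, so the smoothing estimate can
    -- be used twice.
    have e1 : B N (φ N s) = expFlow (B N) (s / 2) (B N (φ N (s / 2))) := by
      rw [← commute_expFlow (Commute.refl (B N)), hφ]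
      simp only
      rw [← expFlow_add, add_halves]
    rw [e1]
    calc _ ≤ K * ‖B N (φ N (s / 2))‖ := smooth N _ _ (by linarith)
      _ ≤ K * (K * ‖diagTrunc e 1 N x‖) :=
        mul_le_mul_of_nonneg_left (smooth N _ _ (by linarith)) hK0.le
      _ ≤ K * (K * ‖x‖) := by gcongr; exact norm_diagTrunc_one_le e N x
      _ = _ := by ring
  have dφ : ∀ N s, HasDerivAt (φ N) (B N (φ N s)) s := fun N s => hasDerivAt_expFlow _ _ _
  have ddφ : ∀ N s, HasDerivAt (fun s => B N (φ N s)) (B N (B N (φ N s))) s := fun N s =>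
    ((B N).restrictScalars ℝ).hasFDerivAt.comp_hasDerivAt s (dφ N s)
  have lip : ∀ N (t s : ℝ), t₁ ≤ t → t ≤ s →
      ‖B N (φ N s) - B N (φ N t)‖ ≤ K ^ 2 * ‖x‖ * (s - t) := by
    intro N t s ht hts
    have := (convex_Ici t).norm_image_sub_le_of_norm_hasDerivWithin_le
      (f := fun s => B N (φ N s)) (f' := fun s => B N (B N (φ N s))) (C := K ^ 2 * ‖x‖)
      (fun r _ => (ddφ N r).hasDerivWithinAt)
      (fun r hr => second N r (ht.trans hr)) (mem_Ici.2 le_rfl) (mem_Ici.2 hts)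
    rwa [Real.norm_of_nonneg (sub_nonneg.2 hts)] at this
  set C := 2 * (K ^ 2 * ‖x‖) with hC
  have hC0 : 0 ≤ C := by positivity
  -- The interpolation step: `C d ≤ ε / 2`, with `C + 1` because `C` may vanish, while closeness `ε
  -- d / 4` of the functions contributes the other `ε / 2`.
  set d := ε / (2 * (C + 1)) with hd
  have hd0 : 0 < d := by positivity
  obtain ⟨N₀, hN₀⟩ := exists_norm_galerkin_sub_le hlam hmono htends h x
    (show 0 < ε * d / 4 by positivity)
  refine ⟨N₀, fun N hN M hM t ht => ?_⟩
  have := norm_deriv_le_of_lipschitz (f := fun s => φ M s - φ N s)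
    (f' := fun s => B M (φ M s) - B N (φ N s)) (t := t) (ε := ε * d / 4) (M := C) hd0
    (fun s _ => (dφ M s).sub (dφ N s))
    (fun s hs => hN₀ N hN M hM s (by linarith [hs.1])) ?_ hC0
  · refine this.trans ?_
    have e1 : 2 * (ε * d / 4) / d = ε / 2 := by field_simp; ring
    have e2 : C * d ≤ ε / 2 := by
      have : C * d = ε / 2 * (C / (C + 1)) := by rw [hd]; field_simp
      rw [this]
      have : C / (C + 1) ≤ 1 := by rw [div_le_one (by positivity)]; linarith
      nlinarith
    linarith
  · intro s hs
    calc _ = ‖(B M (φ M s) - B M (φ M t)) - (B N (φ N s) - B N (φ N t))‖ := by congr 1; abel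
      _ ≤ _ := norm_sub_le _ _
      _ ≤ _ := add_le_add (lip M t s ht hs.1) (lip N t s ht hs.1)
      _ = _ := by rw [hC]; ring

/-- Existence of solutions of the evolution equation in coordinates. -/
theorem exists_coordinate_solution (hlam : ∀ j, 0 < lam j) (hmono : Monotone lam)
    (htends : Tendsto lam atTop atTop) (h : IsRelBounded e lam ℓ a) (x : H) :
    ∃ φ φ' : ℝ → H, φ 0 = x ∧ ContinuousOn φ (Ici 0) ∧ ∀ t, 0 < t → HasDerivAt φ (φ' t) t ∧
      (Summable fun j => lam j ^ 2 * ‖inner ℂ (e j) (φ t)‖ ^ 2) ∧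
      ∀ j, inner ℂ (e j) (φ' t) =
        Complex.I * inner ℂ (ℓ j) (φ t) - lam j * inner ℂ (e j) (φ t) := by
  set B := galerkinOp e lam ℓ with hB
  set u : ℕ → ℝ → H := fun N t => expFlow (B N) t (diagTrunc e 1 N x) with hu
  have uc : UniformCauchySeqOn u atTop (Ici 0) := by
    rw [Metric.uniformCauchySeqOn_iff]
    intro ε hε
    obtain ⟨N₀, hN₀⟩ := exists_norm_galerkin_sub_le hlam hmono htends h x (half_pos hε)
    refine ⟨N₀, fun m hm n hn t ht => ?_⟩
    rw [dist_eq_norm]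
    exact (hN₀ n hn m hm t ht).trans_lt (half_lt_self hε)
  have uc' : ∀ t₁, 0 < t₁ → UniformCauchySeqOn (fun N t => B N (u N t)) atTop (Ici t₁) := by
    intro t₁ ht₁
    rw [Metric.uniformCauchySeqOn_iff]
    intro ε hε
    obtain ⟨N₀, hN₀⟩ := exists_norm_galerkin_deriv_sub_le hlam hmono htends h x (half_pos hε) ht₁
    refine ⟨N₀, fun m hm n hn t ht => ?_⟩
    rw [dist_eq_norm]
    exact (hN₀ n hn m hm t ht).trans_lt (half_lt_self hε)
  have lim : ∀ t, ∃ y, 0 ≤ t → Tendsto (fun N => u N t) atTop (𝓝 y) := by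
    intro t
    by_cases ht : 0 ≤ t
    · obtain ⟨y, hy⟩ := cauchySeq_tendsto_of_complete (uc.cauchySeq ht)
      exact ⟨y, fun _ => hy⟩
    · exact ⟨0, fun h => absurd h ht⟩
  have lim' : ∀ t, ∃ y, 0 < t → Tendsto (fun N => B N (u N t)) atTop (𝓝 y) := by
    intro t
    by_cases ht : 0 < t
    · obtain ⟨y, hy⟩ := cauchySeq_tendsto_of_complete ((uc' t ht).cauchySeq (mem_Ici.2 le_rfl))
      exact ⟨y, fun _ => hy⟩
    · exact ⟨0, fun h => absurd h ht⟩
  choose φ hφ using lim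
  choose φ' hφ' using lim'
  have du : ∀ N s, HasDerivAt (u N) (B N (u N s)) s := fun N s => hasDerivAt_expFlow _ _ _
  refine ⟨φ, φ', ?_, ?_, ?_⟩
  · refine tendsto_nhds_unique (hφ 0 le_rfl) ?_
    simpa only [hu, expFlow_zero] using tendsto_diagTrunc_one e x
  · refine (uc.tendstoUniformlyOn_of_tendsto fun t ht => hφ t ht).continuousOn
      (Frequently.of_forall fun N => (continuous_expFlow _ _).continuousOn)
  · intro t ht
    refine ⟨?_, ?_⟩
    -- Derivatives converge uniformly only away from `0`, so the limit theorem is applied on `(t /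
    -- 2, ∞)`.
    · have ht2 : 0 < t / 2 := half_pos ht
      have := ((uc' (t / 2) ht2).tendstoUniformlyOn_of_tendsto
        fun s hs => hφ' s (ht2.trans_le hs)).mono Ioi_subset_Ici_self
      exact hasDerivAt_of_tendstoUniformlyOn isOpen_Ioi this
        (Eventually.of_forall fun N s _ => du N s)
        (fun s hs => hφ s (ht2.trans hs).le) (mem_Ioi.2 (half_lt_self ht))
    · refine limit_galerkinOp hlam h (x := fun N => u N t) (fun N => ?_) (hφ t ht.le) (hφ' t ht)
      rw [hu]
      simp only
      rw [commute_expFlow (commute_galerkinOp N), diagTrunc_one_diagTrunc_one, min_self]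

end Limit

/-! ### Translation to the unbounded operators: existence and uniqueness. -/

section Wellposedness

variable {H : Type*} [NormedAddCommGroup H] [InnerProductSpace ℂ H]
  {Γ L : H →ₗ.[ℂ] H} {lam : ℕ → ℝ} {e : HilbertBasis ℕ ℂ H}

theorem HasPositiveDiscreteSpectrum.lam_pos (h : HasPositiveDiscreteSpectrum Γ lam e) (j : ℕ) :
    0 < lam j := h.pos.trans_le (h.mono (Nat.zero_le j))

theorem mem_sobolevSpace_one {x : H} :
    x ∈ sobolevSpace lam e 1 ↔ Summable fun j => lam j * ‖inner ℂ (e j) x‖ ^ 2 := by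
  simp only [sobolevSpace, mem_ofPred_eq, pow_one, e.repr_apply_apply]

theorem sq_sobolevNorm_one (hlam : ∀ j, 0 < lam j) (x : H) :
    sobolevNorm lam e 1 x ^ 2 = ∑' j, lam j * ‖inner ℂ (e j) x‖ ^ 2 := by
  simp only [sobolevNorm, pow_one, e.repr_apply_apply]
  exact Real.sq_sqrt (tsum_nonneg fun j => mul_nonneg (hlam j).le (by positivity))

theorem hasSum_sobolevNorm_one (hlam : ∀ j, 0 < lam j) {x : H} (hx : x ∈ sobolevSpace lam e 1) :
    HasSum (fun j => lam j * ‖inner ℂ (e j) x‖ ^ 2) (sobolevNorm lam e 1 x ^ 2) := by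
  rw [sq_sobolevNorm_one hlam]
  exact (mem_sobolevSpace_one.1 hx).hasSum

theorem hasSum_diagTrunc_one (N : ℕ) (u : H) :
    HasSum (fun j => lam j * ‖inner ℂ (e j) (diagTrunc e 1 N u)‖ ^ 2)
      (∑ j ∈ Finset.range N, lam j * ‖inner ℂ (e j) u‖ ^ 2) := by
  have : ∀ j, lam j * ‖inner ℂ (e j) (diagTrunc e 1 N u)‖ ^ 2
      = if j ∈ Finset.range N then lam j * ‖inner ℂ (e j) u‖ ^ 2 else 0 := by
    intro j
    rw [inner_diagTrunc]
    by_cases h : j < N <;> simp [h]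
  simp only [this]
  rw [← Finset.sum_congr rfl fun j hj => if_pos hj]
  exact hasSum_sum_of_ne_finset_zero fun j hj => if_neg hj

theorem diagTrunc_one_mem_sobolevSpace (N : ℕ) (u : H) :
    diagTrunc e 1 N u ∈ sobolevSpace lam e 1 :=
  mem_sobolevSpace_one.2 (hasSum_diagTrunc_one N u).summable

theorem basis_mem_sobolevSpace (j : ℕ) : e j ∈ sobolevSpace lam e 1 := by
  have : e j = diagTrunc e 1 (j + 1) (e j) := by
    refine ext_inner_basis e fun k => ?_
    rw [inner_diagTrunc, orthonormal_iff_ite.1 e.orthonormal]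
    by_cases h : k = j <;> simp [h]
  rw [this]
  exact diagTrunc_one_mem_sobolevSpace _ _

/-- Truncated vectors lie in `H^1`, where the bound on `L` applies. The constant grows with `A`,
which is harmless because it serves existence only. -/
theorem isRelBounded_of_symmetric (hlam : ∀ j, 0 < lam j) (hL : IsSymmetricOp L)
    (hdom : sobolevSpace lam e 1 ⊆ (L.domain : Set H)) {C : ℝ}
    (hC : ∀ ψ : L.domain, (ψ : H) ∈ sobolevSpace lam e 1 → ‖L ψ‖ ≤ C * sobolevNorm lam e 1 ψ)
    (A : ℝ) :
    IsRelBounded e lam (fun j => (A : ℂ) • L ⟨e j, hdom (basis_mem_sobolevSpace j)⟩)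
      (|A| * C) where
  symm i j := by
    rw [inner_smul_left, inner_smul_right, Complex.conj_ofReal,
      hL ⟨e i, hdom (basis_mem_sobolevSpace i)⟩ ⟨e j, hdom (basis_mem_sobolevSpace j)⟩]
  bound N u := by
    have hmem := diagTrunc_one_mem_sobolevSpace (lam := lam) (e := e) N u
    have h1 : truncOp e (fun j => (A : ℂ) • L ⟨e j, hdom (basis_mem_sobolevSpace j)⟩) N u =
        (A : ℂ) • L ⟨diagTrunc e 1 N u, hdom hmem⟩ := by
      have : (⟨diagTrunc e 1 N u, hdom hmem⟩ : L.domain) = ∑ j ∈ Finset.range N,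
          inner ℂ (e j) u • (⟨e j, hdom (basis_mem_sobolevSpace j)⟩ : L.domain) := by
        ext
        simp [diagTrunc_apply]
      rw [this, ← LinearPMap.toFun_eq_coe, map_sum, truncOp_apply, Finset.smul_sum]
      refine Finset.sum_congr rfl fun j _ => ?_
      rw [map_smul, smul_comm]
      rfl
    have h2 : sobolevNorm lam e 1 (diagTrunc e 1 N u) =
        ‖diagTrunc e (fun j => Real.sqrt (lam j)) N u‖ := by
      have : sobolevNorm lam e 1 (diagTrunc e 1 N u) ^ 2 = ‖sqrtTrunc e lam N u‖ ^ 2 := by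
        rw [normSq_sqrtTrunc hlam, sq_sobolevNorm_one hlam, (hasSum_diagTrunc_one N u).tsum_eq]
      exact (pow_left_inj₀ (Real.sqrt_nonneg _) (norm_nonneg _) two_ne_zero).1 this
    rw [h1, norm_smul, Complex.norm_real, Real.norm_eq_abs, mul_assoc, ← h2]
    exact mul_le_mul_of_nonneg_left (hC ⟨_, hdom hmem⟩ hmem) (abs_nonneg A)

theorem inner_apply_self_im (hL : IsSymmetricOp L) (x : L.domain) :
    (inner ℂ (x : H) (L x)).im = 0 := by
  have h : (starRingEnd ℂ) (inner ℂ (x : H) (L x)) = inner ℂ (x : H) (L x) := by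
    rw [inner_conj_symm]; exact hL x x
  exact Complex.conj_eq_iff_im.1 h

theorem IsSolution.sub {A : ℝ} {φ₀ φ₀' : H} {φ φ' : ℝ → H} (hφ : IsSolution Γ L A φ₀ φ)
    (hφ' : IsSolution Γ L A φ₀' φ') : IsSolution Γ L A (φ₀ - φ₀') (φ - φ') where
  initial := by rw [Pi.sub_apply, hφ.initial, hφ'.initial]
  continuousOn := hφ.continuousOn.sub hφ'.continuousOn
  equation t ht := by
    obtain ⟨h1, h2, hd⟩ := hφ.equation t ht
    obtain ⟨h1', h2', hd'⟩ := hφ'.equation t ht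
    refine ⟨Γ.domain.sub_mem h1 h1', L.domain.sub_mem h2 h2', (hd.sub hd').congr_deriv ?_⟩
    have e1 := L.map_sub ⟨φ t, h2⟩ ⟨φ' t, h2'⟩
    have e2 := Γ.map_sub ⟨φ t, h1⟩ ⟨φ' t, h1'⟩
    change _ = (Complex.I * (A : ℂ)) • L (⟨φ t, h2⟩ - ⟨φ' t, h2'⟩) - Γ (⟨φ t, h1⟩ - ⟨φ' t, h1'⟩)
    rw [e1, e2, smul_sub]
    abel

variable [CompleteSpace H]

theorem inner_apply_eq_of_isSelfAdjoint (hΓ : IsSelfAdjoint Γ) (x y : Γ.domain) :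
    inner ℂ (Γ x) (y : H) = inner ℂ (x : H) (Γ y) := by
  have h := LinearPMap.adjoint_isFormalAdjoint hΓ.dense_domain
  rw [LinearPMap.isSelfAdjoint_def.1 hΓ] at h
  exact h x y

theorem inner_basis_apply (hΓ : IsSelfAdjoint Γ) (hs : HasPositiveDiscreteSpectrum Γ lam e)
    (x : Γ.domain) (j : ℕ) : inner ℂ (e j) (Γ x) = lam j * inner ℂ (e j) (x : H) := by
  obtain ⟨h, he⟩ := hs.eigen j
  rw [← inner_apply_eq_of_isSelfAdjoint hΓ ⟨e j, h⟩ x, he, inner_smul_left, Complex.conj_ofReal]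

/-- The vector with coordinates `lam j * ⟨e j, x⟩` represents `y ↦ ⟨x, Γ y⟩`, so `x` lies in the
domain of the adjoint, which is that of `Γ`. -/
theorem mem_domain_of_summable (hΓ : IsSelfAdjoint Γ) (hs : HasPositiveDiscreteSpectrum Γ lam e)
    {x : H} (hx : Summable fun j => lam j ^ 2 * ‖inner ℂ (e j) x‖ ^ 2) : x ∈ Γ.domain := by
  have hmem : Memℓp (fun j => (lam j : ℂ) * inner ℂ (e j) x) 2 := by
    refine memℓp_gen ?_
    convert hx using 2 with j
    simp [mul_pow]
  set w : H := e.repr.symm ⟨_, hmem⟩ with hw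
  have hwj : ∀ j, inner ℂ (e j) w = (lam j : ℂ) * inner ℂ (e j) x := by
    intro j
    rw [← e.repr_apply_apply, hw, LinearIsometryEquiv.apply_symm_apply]
  rw [← LinearPMap.isSelfAdjoint_def.1 hΓ]
  refine LinearPMap.mem_adjoint_domain_of_exists x ⟨w, fun y => ?_⟩
  refine (e.hasSum_inner_mul_inner w y).unique ?_
  convert e.hasSum_inner_mul_inner x (Γ y) using 2 with j
  rw [inner_basis_apply hΓ hs, ← inner_conj_symm w, hwj, ← inner_conj_symm x]
  simp only [map_mul, Complex.conj_ofReal]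
  ring

theorem domain_subset_sobolevSpace (hΓ : IsSelfAdjoint Γ)
    (hs : HasPositiveDiscreteSpectrum Γ lam e) {x : H} (hx : x ∈ Γ.domain) :
    x ∈ sobolevSpace lam e 1 := by
  have h := (hasSum_normSq_inner e (Γ ⟨x, hx⟩)).summable.mul_left (lam 0)⁻¹
  rw [mem_sobolevSpace_one]
  refine h.of_nonneg_of_le (fun j => mul_nonneg (hs.lam_pos j).le (by positivity)) fun j => ?_
  rw [inner_basis_apply hΓ hs, norm_mul, Complex.norm_real, Real.norm_of_nonneg (hs.lam_pos j).le]
  have h0 := hs.pos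
  have hj : 1 ≤ (lam 0)⁻¹ * lam j := by
    rw [inv_mul_eq_div, one_le_div h0]
    exact hs.mono (Nat.zero_le j)
  have := hs.lam_pos j
  calc lam j * ‖inner ℂ (e j) x‖ ^ 2
      ≤ (lam 0)⁻¹ * lam j * (lam j * ‖inner ℂ (e j) x‖ ^ 2) :=
        le_mul_of_one_le_left (by positivity) hj
    _ = _ := by ring

theorem re_inner_apply_self (hΓ : IsSelfAdjoint Γ) (hs : HasPositiveDiscreteSpectrum Γ lam e)
    (x : Γ.domain) : (inner ℂ (x : H) (Γ x)).re = sobolevNorm lam e 1 x ^ 2 := by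
  refine (Complex.hasSum_re (e.hasSum_inner_mul_inner (x : H) (Γ x))).unique ?_
  convert hasSum_sobolevNorm_one hs.lam_pos (domain_subset_sobolevSpace hΓ hs x.2) using 2 with j
  rw [inner_basis_apply hΓ hs, ← inner_conj_symm (x : H), mul_left_comm,
    ← Complex.normSq_eq_conj_mul_self, ← Complex.ofReal_mul, Complex.ofReal_re,
    Complex.normSq_eq_norm_sq]

theorem IsSolution.hasDerivAt_normSq {A : ℝ} {φ₀ : H} {φ : ℝ → H} (hφ : IsSolution Γ L A φ₀ φ)
    (hΓ : IsSelfAdjoint Γ) (hs : HasPositiveDiscreteSpectrum Γ lam e) (hL : IsSymmetricOp L)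
    {t : ℝ} (ht : 0 < t) :
    HasDerivAt (fun s => ‖φ s‖ ^ 2) (-2 * sobolevNorm lam e 1 (φ t) ^ 2) t := by
  obtain ⟨h1, h2, hd⟩ := hφ.equation t ht
  refine (RelaxationEnhancing.hasDerivAt_normSq hd).congr_deriv ?_
  rw [inner_sub_right, Complex.sub_re, re_inner_apply_self hΓ hs ⟨φ t, h1⟩, inner_smul_right]
  have := inner_apply_self_im hL ⟨φ t, h2⟩
  simp [Complex.mul_re, this]

theorem IsSolution.antitoneOn_normSq {A : ℝ} {φ₀ : H} {φ : ℝ → H} (hφ : IsSolution Γ L A φ₀ φ)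
    (hΓ : IsSelfAdjoint Γ) (hs : HasPositiveDiscreteSpectrum Γ lam e) (hL : IsSymmetricOp L) :
    AntitoneOn (fun s => ‖φ s‖ ^ 2) (Ici 0) :=
  antitoneOn_Ici_of_hasDerivAt (hφ.continuousOn.norm.pow 2)
    (fun _ ht => hφ.hasDerivAt_normSq hΓ hs hL ht)
    fun _ _ => by nlinarith [sq_nonneg (sobolevNorm lam e 1 (φ ‹ℝ›))]

theorem IsSolution.unique {A : ℝ} {φ₀ : H} {φ φ' : ℝ → H} (hφ : IsSolution Γ L A φ₀ φ)
    (hφ' : IsSolution Γ L A φ₀ φ') (hΓ : IsSelfAdjoint Γ)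
    (hs : HasPositiveDiscreteSpectrum Γ lam e) (hL : IsSymmetricOp L) : EqOn φ φ' (Ici 0) := by
  intro t ht
  have h := (hφ.sub hφ').antitoneOn_normSq hΓ hs hL (mem_Ici.2 le_rfl) ht ht
  simp only [(hφ.sub hφ').initial, sub_self, norm_zero] at h
  have h0 : ‖(φ - φ') t‖ = 0 := by nlinarith [norm_nonneg ((φ - φ') t)]
  exact sub_eq_zero.1 (norm_eq_zero.1 h0)

theorem exists_isSolution (hΓ : IsSelfAdjoint Γ) (hs : HasPositiveDiscreteSpectrum Γ lam e)
    (hL : IsSymmetricOp L) (hdom : sobolevSpace lam e 1 ⊆ (L.domain : Set H))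
    (hbound : ∃ C : ℝ, ∀ ψ : L.domain, (ψ : H) ∈ sobolevSpace lam e 1 →
      ‖L ψ‖ ≤ C * sobolevNorm lam e 1 (ψ : H)) (A : ℝ) (φ₀ : H) :
    ∃ φ, IsSolution Γ L A φ₀ φ := by
  obtain ⟨C, hC⟩ := hbound
  obtain ⟨φ, φ', h0, hc, hd⟩ := exists_coordinate_solution hs.lam_pos hs.mono hs.tendsto
    (isRelBounded_of_symmetric hs.lam_pos hL hdom hC A) φ₀
  refine ⟨φ, h0, hc, fun t ht => ?_⟩
  obtain ⟨hd, hsum, hcoef⟩ := hd t ht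
  have h1 := mem_domain_of_summable hΓ hs hsum
  have h2 := hdom (domain_subset_sobolevSpace hΓ hs h1)
  refine ⟨h1, h2, hd.congr_deriv (ext_inner_basis e fun j => ?_)⟩
  rw [hcoef, inner_sub_right, inner_basis_apply hΓ hs ⟨φ t, h1⟩, inner_smul_right, inner_smul_left,
    Complex.conj_ofReal, hL ⟨e j, hdom (basis_mem_sobolevSpace j)⟩ ⟨φ t, h2⟩, mul_assoc]

end Wellposedness

/-! ### Eigenvectors in `H^1` prevent relaxation. -/

section Necessity

variable {H : Type*} [NormedAddCommGroup H] [InnerProductSpace ℂ H] [CompleteSpace H]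
  {Γ L : H →ₗ.[ℂ] H} {lam : ℕ → ℝ} {e : HilbertBasis ℕ ℂ H}

/-- `ψ` need not lie in the domain of `Γ`; the arithmetic-geometric mean inequality in each
coordinate replaces moving half of `Γ` onto `ψ`. -/
theorem two_mul_norm_inner_apply_le (hΓ : IsSelfAdjoint Γ)
    (hs : HasPositiveDiscreteSpectrum Γ lam e) {ψ : H} (hψ : ψ ∈ sobolevSpace lam e 1)
    (x : Γ.domain) :
    2 * ‖inner ℂ ψ (Γ x)‖ ≤ sobolevNorm lam e 1 ψ ^ 2 + sobolevNorm lam e 1 (x : H) ^ 2 := by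
  have h1 := hasSum_sobolevNorm_one hs.lam_pos hψ
  have h2 := hasSum_sobolevNorm_one hs.lam_pos (domain_subset_sobolevSpace hΓ hs x.2)
  have h3 := tsum_of_norm_bounded ((h1.add h2).div_const 2)
    (f := fun j => inner ℂ ψ (e j) * inner ℂ (e j) (Γ x)) fun j => by
      rw [inner_basis_apply hΓ hs, norm_mul, norm_mul, Complex.norm_real,
        Real.norm_of_nonneg (hs.lam_pos j).le, norm_inner_symm ψ]
      have := mul_nonneg (hs.lam_pos j).le
        (sq_nonneg (‖inner ℂ (e j) ψ‖ - ‖inner ℂ (e j) (x : H)‖))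
      linarith
  rw [e.tsum_inner_mul_inner] at h3
  linarith

/-- A solution starting at a normalized eigenvector of `L` in `H^1` keeps a fixed part of its
norm for a time independent of `A`. -/
theorem IsSolution.normSq_ge_of_isEigenvector {A : ℝ} {ψ : H} {φ : ℝ → H}
    (hφ : IsSolution Γ L A ψ φ) (hΓ : IsSelfAdjoint Γ)
    (hs : HasPositiveDiscreteSpectrum Γ lam e) (hL : IsSymmetricOp L)
    (hψ : ψ ∈ sobolevSpace lam e 1) (h1 : ‖ψ‖ = 1) (heig : IsEigenvector L ψ) {t : ℝ}
    (ht : 0 ≤ t) : 1 / 2 - sobolevNorm lam e 1 ψ ^ 2 * t ≤ ‖φ t‖ ^ 2 := by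
  obtain ⟨-, hψL, μ, hμ⟩ := heig
  have hconj : (starRingEnd ℂ) μ = μ := by
    have := hL ⟨ψ, hψL⟩ ⟨ψ, hψL⟩
    simp only [hμ, inner_smul_left, inner_smul_right] at this
    have hne : inner ℂ ψ ψ ≠ 0 := by
      rw [inner_self_ne_zero]
      rintro rfl
      simp at h1
    exact mul_right_cancel₀ hne this
  have hmim : μ.im = 0 := Complex.conj_eq_iff_im.1 hconj
  set q := sobolevNorm lam e 1 ψ with hq
  have hle : ∀ s, 0 ≤ s → ‖φ s‖ ≤ 1 := by
    intro s hs0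
    have := hφ.antitoneOn_normSq hΓ hs hL (mem_Ici.2 le_rfl) hs0 hs0
    simp only [hφ.initial, h1] at this
    nlinarith [norm_nonneg (φ s)]
  have hz : ∀ s, 0 ≤ s → ‖inner ℂ ψ (φ s)‖ ≤ ‖φ s‖ := fun s _ => by
    simpa [h1] using norm_inner_le_norm (𝕜 := ℂ) ψ (φ s)
  have hd : ∀ s, 0 < s → ∃ d, HasDerivAt (fun s => ‖inner ℂ ψ (φ s)‖ ^ 2) d s ∧
      -(q ^ 2 + sobolevNorm lam e 1 (φ s) ^ 2) ≤ d := by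
    intro s hs0
    obtain ⟨k1, k2, hd⟩ := hφ.equation s hs0
    have hzd : HasDerivAt (fun s => inner ℂ ψ (φ s))
        (inner ℂ ψ ((Complex.I * (A : ℂ)) • L ⟨φ s, k2⟩ - Γ ⟨φ s, k1⟩)) s :=
      ((innerSL ℂ ψ).restrictScalars ℝ).hasFDerivAt.comp_hasDerivAt s hd
    refine ⟨_, RelaxationEnhancing.hasDerivAt_normSq hzd, ?_⟩
    set z := inner ℂ ψ (φ s)
    have e1 : inner ℂ ψ (L ⟨φ s, k2⟩) = μ * z := by
      rw [← hL ⟨ψ, hψL⟩ ⟨φ s, k2⟩, hμ, inner_smul_left, hconj]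
    rw [inner_sub_right, inner_smul_right, e1, inner_sub_right, Complex.sub_re]
    -- `μ` is real, so the `L` term only rotates `z` and drops out for every `A`.
    have e2 : (inner ℂ z (Complex.I * (A : ℂ) * (μ * z))).re = 0 := by
      rw [RCLike.inner_apply]
      have : Complex.I * (A : ℂ) * (μ * z) * (starRingEnd ℂ) z =
          Complex.I * ((A : ℂ) * μ * (z * (starRingEnd ℂ) z)) := by ring
      rw [this, Complex.mul_conj, Complex.I_mul_re]
      simp [hmim]
    rw [e2]
    have e3 : (inner ℂ z (inner ℂ ψ (Γ ⟨φ s, k1⟩))).re ≤ 1 * ‖inner ℂ ψ (Γ ⟨φ s, k1⟩)‖ := by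
      refine (Complex.re_le_norm _).trans ((norm_inner_le_norm _ _).trans ?_)
      exact mul_le_mul_of_nonneg_right ((hz s hs0.le).trans (hle s hs0.le)) (norm_nonneg _)
    have e4 := two_mul_norm_inner_apply_le hΓ hs hψ ⟨φ s, k1⟩
    linarith
  choose! d hd hdle using hd
  -- The term `1 / 2 * ‖φ‖²` decreases at rate exactly `‖φ‖₁²` and cancels the uncontrolled part of
  -- `hdle`.
  have hanti := antitoneOn_Ici_of_hasDerivAt (a := 0)
    (f := fun s => 1 / 2 * ‖φ s‖ ^ 2 - q ^ 2 * s - ‖inner ℂ ψ (φ s)‖ ^ 2)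
    (f' := fun s => 1 / 2 * (-2 * sobolevNorm lam e 1 (φ s) ^ 2) - q ^ 2 * 1 - d s) ?_ ?_ ?_
    (mem_Ici.2 le_rfl) (mem_Ici.2 ht) ht
  · simp only [hφ.initial, h1, inner_self_eq_norm_sq_to_K] at hanti
    simp at hanti
    have := hz t ht
    have h3 : ‖inner ℂ ψ (φ t)‖ ^ 2 ≤ ‖φ t‖ ^ 2 := pow_le_pow_left₀ (norm_nonneg _) this 2
    nlinarith [sq_nonneg ‖φ t‖]
  · exact (((hφ.continuousOn.norm.pow 2).const_mul _).sub (by fun_prop)).sub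
      ((continuousOn_const.inner hφ.continuousOn).norm.pow 2)
  · intro s hs0
    exact (((hφ.hasDerivAt_normSq hΓ hs hL hs0).const_mul _).sub
      ((hasDerivAt_id s).const_mul _)).sub (hd s hs0)
  · intro s hs0
    have := hdle s hs0
    linarith

theorem no_eigenvector_of_relaxation (hΓ : IsSelfAdjoint Γ)
    (hs : HasPositiveDiscreteSpectrum Γ lam e) (hL : IsSymmetricOp L)
    (hex : ∀ (A : ℝ) (φ₀ : H), ∃ φ, IsSolution Γ L A φ₀ φ)
    (hrelax : ∀ τ : ℝ, 0 < τ → ∀ δ : ℝ, 0 < δ → ∃ A₀ : ℝ, ∀ A : ℝ, A₀ < A →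
        ∀ φ₀ : H, ‖φ₀‖ = 1 → ∀ φ : ℝ → H, IsSolution Γ L A φ₀ φ → ‖φ τ‖ < δ) :
    ¬ ∃ ψ ∈ sobolevSpace lam e 1, IsEigenvector L ψ := by
  rintro ⟨ψ, hψ, hne, hdom, μ, hμ⟩
  set c : ℂ := ((‖ψ‖⁻¹ : ℝ) : ℂ) with hc
  have hnorm : ‖ψ‖ ≠ 0 := norm_ne_zero_iff.2 hne
  have h1 : ‖c • ψ‖ = 1 := by
    rw [norm_smul, hc, Complex.norm_real, norm_inv, norm_norm, inv_mul_cancel₀ hnorm]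
  have hψ' : c • ψ ∈ sobolevSpace lam e 1 := by
    rw [mem_sobolevSpace_one] at hψ ⊢
    refine (hψ.mul_left (‖c‖ ^ 2)).congr fun j => ?_
    rw [inner_smul_right, norm_mul]
    ring
  have heig : IsEigenvector L (c • ψ) := by
    refine ⟨fun h => by simp [h] at h1, L.domain.smul_mem c hdom, μ, ?_⟩
    have := L.map_smul c ⟨ψ, hdom⟩
    rw [hμ, smul_comm] at this
    exact this
  set q := sobolevNorm lam e 1 (c • ψ)
  -- Makes `q² τ ≤ 1 / 4`, hence `‖φ τ‖² ≥ 1 / 4`, against `‖φ τ‖ < 1 / 2`.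
  set τ := 1 / (4 * (q ^ 2 + 1)) with hτ
  have hτ0 : 0 < τ := by positivity
  obtain ⟨A₀, hA₀⟩ := hrelax τ hτ0 (1 / 2) (by norm_num)
  obtain ⟨φ, hφ⟩ := hex (A₀ + 1) (c • ψ)
  have h2 := hA₀ (A₀ + 1) (by linarith) _ h1 φ hφ
  have h3 := hφ.normSq_ge_of_isEigenvector hΓ hs hL hψ' h1 heig hτ0.le
  have h4 : q ^ 2 * τ ≤ 1 / 4 := by
    rw [hτ, mul_one_div, div_le_div_iff₀ (by positivity) (by norm_num)]
    linarith
  change 1 / 2 - q ^ 2 * τ ≤ ‖φ τ‖ ^ 2 at h3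
  nlinarith [norm_nonneg (φ τ)]

end Necessity

/-! ### Weak operator limits, compactness and commutation with `L`. -/

section WeakLimit

variable {H : Type*} [NormedAddCommGroup H] [InnerProductSpace ℂ H]

/-- Uniformly bounded hermitian forms converge weakly, along an ultrafilter, to the form of a
bounded symmetric operator. -/
theorem exists_weak_limit [CompleteSpace H] (𝒰 : Ultrafilter ℕ) {k : ℕ → H → H → ℂ} {M : ℝ}
    (hadd : ∀ n u v w, k n u (v + w) = k n u v + k n u w)
    (hsmul : ∀ n (c : ℂ) u v, k n u (c • v) = c * k n u v)
    (hconj : ∀ n u v, (starRingEnd ℂ) (k n u v) = k n v u)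
    (hbound : ∀ n u v, ‖k n u v‖ ≤ M * ‖u‖ * ‖v‖) :
    ∃ K : H →L[ℂ] H, K.IsSymmetric ∧
      ∀ u v, Tendsto (fun n => k n u v) 𝒰 (𝓝 (inner ℂ u (K v))) := by
  have lim : ∀ u v, ∃ z ∈ Metric.closedBall (0 : ℂ) (M * ‖u‖ * ‖v‖),
      Tendsto (fun n => k n u v) 𝒰 (𝓝 z) := by
    intro u v
    -- An ultrafilter on a compact disc converges, which yields limits for all pairs at once without
    -- extracting subsequences.
    obtain ⟨z, hz, hle⟩ := (isCompact_closedBall (0 : ℂ) (M * ‖u‖ * ‖v‖)).ultrafilter_le_nhds'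
      (𝒰.map fun n => k n u v) (Ultrafilter.mem_map.2 (Eventually.of_forall fun n => by
        simpa using hbound n u v))
    exact ⟨z, hz, hle⟩
  choose κ hκb hκ using lim
  have cadd : ∀ u v w, κ u (v + w) = κ u v + κ u w := fun u v w =>
    tendsto_nhds_unique (hκ u (v + w)) (by simpa only [hadd] using (hκ u v).add (hκ u w))
  have csmul : ∀ (c : ℂ) u v, κ u (c • v) = c * κ u v := fun c u v =>
    tendsto_nhds_unique (hκ u (c • v)) (by simpa only [hsmul] using (hκ u v).const_mul c)
  have cconj : ∀ u v, (starRingEnd ℂ) (κ u v) = κ v u := fun u v =>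
    tendsto_nhds_unique ((Complex.continuous_conj.tendsto _).comp (hκ u v))
      (by simpa only [Function.comp_def, hconj] using hκ v u)
  let B : H →L⋆[ℂ] H →L[ℂ] ℂ := LinearMap.mkContinuous₂
    (LinearMap.mk₂'ₛₗ (starRingEnd ℂ) (RingHom.id ℂ) κ
      (fun u u' v => by rw [← cconj v, cadd, map_add, cconj, cconj])
      (fun c u v => by rw [← cconj v, csmul, map_mul, cconj]; rfl)
      cadd (fun c u v => csmul c u v)) M
      fun u v => by simpa using hκb u v
  have hB : ∀ u v, B u v = κ u v := fun _ _ => rfl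
  have hK : ∀ u v, inner ℂ (InnerProductSpace.continuousLinearMapOfBilin B u) v = κ u v :=
    fun u v => by rw [InnerProductSpace.continuousLinearMapOfBilin_apply, hB]
  have hK' : ∀ u v, inner ℂ u (InnerProductSpace.continuousLinearMapOfBilin B v) = κ u v :=
    fun u v => by rw [← inner_conj_symm, hK, cconj]
  refine ⟨InnerProductSpace.continuousLinearMapOfBilin B, fun u v => ?_, fun u v => ?_⟩
  · exact (hK u v).trans (hK' u v).symm
  · rw [hK']
    exact hκ u v

theorem isCompactOperator_diagTrunc (e : HilbertBasis ℕ ℂ H) (f : ℕ → ℝ) (N : ℕ) :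
    IsCompactOperator (diagTrunc e f N) := by
  have : diagTrunc e f N ∈ compactOperator (RingHom.id ℂ) H H := by
    refine Submodule.sum_mem _ fun j _ => Submodule.smul_mem _ _ ?_
    have : IsCompactOperator ((ContinuousLinearMap.toSpanSingleton ℂ (e j)) ∘
        (id : ℂ → ℂ)) :=
      (isCompactOperator_id_iff_locallyCompactSpace (E := ℂ).2 inferInstance).clm_comp
        (ContinuousLinearMap.toSpanSingleton ℂ (e j))
    exact this.comp_clm (innerSL ℂ (e j))
  exact this

/-- An operator with range in `H^1`, bounded as an operator to `H^1`, is compact. -/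
theorem isCompactOperator_of_weighted_bound [CompleteSpace H] {e : HilbertBasis ℕ ℂ H}
    {lam : ℕ → ℝ} (hlam : ∀ j, 0 < lam j) (hmono : Monotone lam) (htends : Tendsto lam atTop atTop)
    {K : H →L[ℂ] H} {M : ℝ}
    (hK : ∀ v, ∀ N, ∑ j ∈ Finset.range N, lam j * ‖inner ℂ (e j) (K v)‖ ^ 2 ≤ M * ‖v‖ ^ 2) :
    IsCompactOperator K := by
  have htail : ∀ N v, lam N * ‖(diagTrunc e 1 N * K - K) v‖ ^ 2 ≤ M * ‖v‖ ^ 2 := by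
    intro N v
    have h1 : Tendsto (fun m => lam N * ‖(diagTrunc e 1 m - diagTrunc e 1 N) (K v)‖ ^ 2) atTop
        (𝓝 (lam N * ‖K v - diagTrunc e 1 N (K v)‖ ^ 2)) :=
      (((tendsto_diagTrunc_one e (K v)).sub tendsto_const_nhds).norm.pow 2).const_mul _
    rw [sub_apply, mul_apply_eq_comp, norm_sub_rev]
    refine le_of_tendsto h1 ((eventually_ge_atTop N).mono fun m hm => ?_)
    refine (normSq_diagTrunc_sub_le hlam hmono hm (K v)).trans ?_
    rw [normSq_sqrtTrunc hlam]
    exact hK v m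
  have hle : ∀ N, ‖diagTrunc e 1 N * K - K‖ ≤ Real.sqrt (M / lam N) := by
    intro N
    refine ContinuousLinearMap.opNorm_le_bound _ (Real.sqrt_nonneg _) fun v => ?_
    rw [← Real.sqrt_sq (norm_nonneg v), ← Real.sqrt_mul' _ (sq_nonneg _)]
    refine Real.le_sqrt_of_sq_le ?_
    rw [div_mul_eq_mul_div, le_div_iff₀ (hlam N), mul_comm]
    exact htail N v
  have hlim : Tendsto (fun N => diagTrunc e 1 N * K) atTop (𝓝 K) := by
    rw [tendsto_iff_norm_sub_tendsto_zero]
    refine squeeze_zero (fun _ => norm_nonneg _) hle ?_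
    have := (Real.continuous_sqrt.tendsto 0).comp (htends.const_div_atTop M)
    simpa [Function.comp_def] using this
  exact isCompactOperator_of_tendsto hlim (Eventually.of_forall fun N =>
    (isCompactOperator_diagTrunc e 1 N).comp_clm K)

/-- If a nonzero compact symmetric operator with range in `H^1` commutes weakly with `L`, then `L`
has an eigenvector in `H^1`. -/
theorem exists_isEigenvector_of_commute [CompleteSpace H] {L : H →ₗ.[ℂ] H} {e : HilbertBasis ℕ ℂ H}
    {lam : ℕ → ℝ} (hL : IsSymmetricOp L) (hdom : sobolevSpace lam e 1 ⊆ (L.domain : Set H))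
    {K : H →L[ℂ] H} (hKc : IsCompactOperator K) (hKs : K.IsSymmetric) (hK0 : K ≠ 0)
    (hKr : ∀ v, K v ∈ sobolevSpace lam e 1)
    (hcomm : ∀ i j, inner ℂ (L ⟨e i, hdom (basis_mem_sobolevSpace i)⟩) (K (e j)) =
      inner ℂ (e i) (K (L ⟨e j, hdom (basis_mem_sobolevSpace j)⟩))) :
    ∃ ψ ∈ sobolevSpace lam e 1, IsEigenvector L ψ := by
  have hsymm : ∀ u v, inner ℂ (K u) v = inner ℂ u (K v) := fun u v => hKs u v
  have hbasis : ∀ i, K (L ⟨e i, hdom (basis_mem_sobolevSpace i)⟩) =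
      L ⟨K (e i), hdom (hKr (e i))⟩ := fun i => ext_inner_basis e fun j => by
    rw [← hcomm, hL ⟨e j, hdom (basis_mem_sobolevSpace j)⟩ ⟨K (e i), hdom (hKr (e i))⟩]
  -- Testing against `e i` moves `K` and `L` onto the basis vector, where they commute; no
  -- approximation of `v` in a graph norm is needed.
  have hLK : ∀ v : L.domain, K (L v) = L ⟨K v, hdom (hKr v)⟩ := fun v =>
    ext_inner_basis e fun i => by
      rw [← hsymm, ← hL ⟨e i, hdom (basis_mem_sobolevSpace i)⟩ ⟨K v, hdom (hKr v)⟩, ← hsymm,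
        hbasis, hL ⟨K (e i), hdom (hKr (e i))⟩ v]
  obtain ⟨μ, hμ, hμ0⟩ : ∃ μ, Module.End.HasEigenvalue (K : Module.End ℂ H) μ ∧ μ ≠ 0 := by
    by_contra! hcon
    exact hK0 ((ContinuousLinearMap.eq_zero_of_forall_hasEigenvalue_eq_zero hKc hKs).1 hcon)
  set E := Module.End.eigenspace (K : Module.End ℂ H) μ with hE
  have hfin : FiniteDimensional ℂ E :=
    ContinuousLinearMap.finite_dimensional_eigenspace hKc μ hμ0
  have hEmem : ∀ v, v ∈ E ↔ K v = μ • v := fun v => Module.End.mem_eigenspace_iff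
  have hE1 : ∀ v ∈ E, v ∈ sobolevSpace lam e 1 := by
    intro v hv
    have : v = K (μ⁻¹ • v) := by
      rw [map_smul, (hEmem v).1 hv, smul_smul, inv_mul_cancel₀ hμ0, one_smul]
    rw [this]
    exact hKr _
  have hED : E ≤ L.domain := fun v hv => hdom (hE1 v hv)
  -- Commutation makes the finite-dimensional `E` invariant under `L`, and a complex matrix has an
  -- eigenvector.
  let F : E →ₗ[ℂ] E := LinearMap.codRestrict E (L.toFun ∘ₗ Submodule.inclusion hED) fun v => by
    rw [hEmem]
    have h1 : K (L ⟨v, hED v.2⟩) = L ⟨K v, hdom (hKr v)⟩ := hLK ⟨v, hED v.2⟩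
    have h2 : (⟨K v, hdom (hKr v)⟩ : L.domain) = μ • ⟨v, hED v.2⟩ :=
      Subtype.ext ((hEmem v).1 v.2)
    rw [h2, L.map_smul] at h1
    exact h1
  have hnt : Nontrivial E := Submodule.nontrivial_iff_ne_bot.2 hμ
  obtain ⟨ν, hν⟩ := Module.End.exists_eigenvalue F
  obtain ⟨w, hw⟩ := hν.exists_hasEigenvector
  refine ⟨w, hE1 w w.2, fun h => hw.2 (Subtype.ext h), hED w.2, ν, ?_⟩
  exact congrArg Subtype.val hw.apply_eq_smul

end WeakLimit

/-! ### The time-averaged correlation form of a trajectory. -/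

section Correlation

variable {H : Type*} [NormedAddCommGroup H] [InnerProductSpace ℂ H]

/-- The time-averaged correlation form `∫₀^τ ⟨u, φ t⟩ ⟨φ t, v⟩ dt`. -/
noncomputable def corr (φ : ℝ → H) (τ : ℝ) (u v : H) : ℂ :=
  ∫ t in (0 : ℝ)..τ, inner ℂ u (φ t) * inner ℂ (φ t) v

variable {φ : ℝ → H} {τ : ℝ}

theorem continuousOn_corr_integrand (hc : ContinuousOn φ (Ici 0)) (u v : H) :
    ContinuousOn (fun t => inner ℂ u (φ t) * inner ℂ (φ t) v) (Ici 0) :=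
  (continuousOn_const.inner hc).mul (hc.inner continuousOn_const)

theorem intervalIntegrable_of_continuousOn_Ici {F : Type*} [NormedAddCommGroup F] {f : ℝ → F}
    (hf : ContinuousOn f (Ici 0)) (hτ : 0 ≤ τ) :
    IntervalIntegrable f MeasureTheory.volume 0 τ :=
  (hf.mono fun t ht => by rw [uIcc_of_le hτ] at ht; exact ht.1).intervalIntegrable

theorem corr_add (hc : ContinuousOn φ (Ici 0)) (hτ : 0 ≤ τ) (u v w : H) :
    corr φ τ u (v + w) = corr φ τ u v + corr φ τ u w := by
  unfold corr
  rw [← intervalIntegral.integral_add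
    (intervalIntegrable_of_continuousOn_Ici (continuousOn_corr_integrand hc u v) hτ)
    (intervalIntegrable_of_continuousOn_Ici (continuousOn_corr_integrand hc u w) hτ)]
  simp only [inner_add_right, mul_add]

theorem corr_smul (c : ℂ) (u v : H) : corr φ τ u (c • v) = c * corr φ τ u v := by
  unfold corr
  rw [← intervalIntegral.integral_const_mul]
  simp only [inner_smul_right, mul_left_comm]

theorem corr_conj (u v : H) : (starRingEnd ℂ) (corr φ τ u v) = corr φ τ v u := by
  unfold corr
  rw [intervalIntegral, intervalIntegral, map_sub, ← integral_conj, ← integral_conj]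
  simp only [map_mul, inner_conj_symm, mul_comm]

theorem norm_corr_le (h1 : ∀ t, 0 ≤ t → ‖φ t‖ ≤ 1) (hτ : 0 ≤ τ) (u v : H) :
    ‖corr φ τ u v‖ ≤ τ * ‖u‖ * ‖v‖ := by
  have := intervalIntegral.norm_integral_le_of_norm_le_const (a := 0) (b := τ)
    (f := fun t => inner ℂ u (φ t) * inner ℂ (φ t) v) (C := ‖u‖ * ‖v‖) fun t ht => by
      rw [uIoc_of_le hτ] at ht
      have h := h1 t ht.1.le
      rw [norm_mul]
      refine mul_le_mul ((norm_inner_le_norm _ _).trans ?_) ((norm_inner_le_norm _ _).trans ?_)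
        (norm_nonneg _) (norm_nonneg _)
      · exact mul_le_of_le_one_right (norm_nonneg _) h
      · exact mul_le_of_le_one_left (norm_nonneg _) h
  rw [sub_zero, abs_of_nonneg hτ] at this
  unfold corr
  linarith

theorem corr_self_re (u : H) : (corr φ τ u u).re = ∫ t in (0 : ℝ)..τ, ‖inner ℂ u (φ t)‖ ^ 2 := by
  have : corr φ τ u u = ((∫ t in (0 : ℝ)..τ, ‖inner ℂ u (φ t)‖ ^ 2 : ℝ) : ℂ) := by
    rw [corr, ← intervalIntegral.integral_ofReal]
    refine intervalIntegral.integral_congr fun t _ => ?_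
    rw [← inner_conj_symm (φ t) u, Complex.mul_conj, Complex.normSq_eq_norm_sq]
  rw [this, Complex.ofReal_re]

/-- The integral of the squared deviation from the mean is nonnegative. -/
theorem sq_intervalIntegral_le {f : ℝ → ℝ} (hf : ContinuousOn f (Ici 0)) (hτ : 0 < τ) :
    (∫ t in (0 : ℝ)..τ, f t) ^ 2 ≤ τ * ∫ t in (0 : ℝ)..τ, f t ^ 2 := by
  set m := ∫ t in (0 : ℝ)..τ, f t with hm
  have h1 : 0 ≤ ∫ t in (0 : ℝ)..τ, (f t - m / τ) ^ 2 :=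
    intervalIntegral.integral_nonneg hτ.le fun t _ => sq_nonneg _
  have i1 := intervalIntegrable_of_continuousOn_Ici hf hτ.le
  have i2 : IntervalIntegrable (fun t => f t ^ 2) MeasureTheory.volume 0 τ :=
    intervalIntegrable_of_continuousOn_Ici (hf.pow 2) hτ.le
  have i3 : IntervalIntegrable (fun _ : ℝ => (m / τ) ^ 2) MeasureTheory.volume 0 τ :=
    intervalIntegrable_const
  have h2 : ∫ t in (0 : ℝ)..τ, (f t - m / τ) ^ 2 =
      (∫ t in (0 : ℝ)..τ, f t ^ 2) - 2 * (m / τ) * m + τ * (m / τ) ^ 2 := by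
    have : ∀ t, (f t - m / τ) ^ 2 = (f t ^ 2 - 2 * (m / τ) * f t) + (m / τ) ^ 2 := fun t => by ring
    simp only [this]
    rw [intervalIntegral.integral_add (i2.sub (i1.const_mul _)) i3,
      intervalIntegral.integral_sub i2 (i1.const_mul _), intervalIntegral.integral_const_mul]
    simp [hm]
  rw [h2] at h1
  have h3 : τ * ((∫ t in (0 : ℝ)..τ, f t ^ 2) - 2 * (m / τ) * m + τ * (m / τ) ^ 2) =
      τ * (∫ t in (0 : ℝ)..τ, f t ^ 2) - m ^ 2 := by
    field_simp
    ring
  have := mul_nonneg hτ.le h1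
  linarith

/-- Cauchy–Schwarz in time. It lets the diagonal entries, which the energy controls, bound every
matrix entry. -/
theorem normSq_corr_le (hc : ContinuousOn φ (Ici 0)) (h1 : ∀ t, 0 ≤ t → ‖φ t‖ ≤ 1) (hτ : 0 < τ)
    (u v : H) : ‖corr φ τ u v‖ ^ 2 ≤ τ * ‖v‖ ^ 2 * (corr φ τ u u).re := by
  have hu : ContinuousOn (fun t => ‖inner ℂ u (φ t)‖) (Ici 0) := (continuousOn_const.inner hc).norm
  have h2 : ‖corr φ τ u v‖ ≤ ‖v‖ * ∫ t in (0 : ℝ)..τ, ‖inner ℂ u (φ t)‖ := by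
    refine (intervalIntegral.norm_integral_le_integral_norm hτ.le).trans ?_
    rw [← intervalIntegral.integral_const_mul]
    refine intervalIntegral.integral_mono_on hτ.le
      (intervalIntegrable_of_continuousOn_Ici (continuousOn_corr_integrand hc u v) hτ.le).norm
      ((intervalIntegrable_of_continuousOn_Ici hu hτ.le).const_mul _) fun t ht => ?_
    rw [norm_mul, mul_comm]
    refine mul_le_mul_of_nonneg_right ((norm_inner_le_norm _ _).trans ?_) (norm_nonneg _)
    exact mul_le_of_le_one_left (norm_nonneg _) (h1 t ht.1)
  calc ‖corr φ τ u v‖ ^ 2 ≤ (‖v‖ * ∫ t in (0 : ℝ)..τ, ‖inner ℂ u (φ t)‖) ^ 2 :=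
        pow_le_pow_left₀ (norm_nonneg _) h2 2
    _ = ‖v‖ ^ 2 * (∫ t in (0 : ℝ)..τ, ‖inner ℂ u (φ t)‖) ^ 2 := mul_pow _ _ _
    _ ≤ ‖v‖ ^ 2 * (τ * ∫ t in (0 : ℝ)..τ, ‖inner ℂ u (φ t)‖ ^ 2) :=
        mul_le_mul_of_nonneg_left (sq_intervalIntegral_le hu hτ) (sq_nonneg _)
    _ = _ := by rw [corr_self_re]; ring

end Correlation

/-! ### Failure of relaxation produces an eigenvector in `H^1`. -/

section Sufficiency

variable {H : Type*} [NormedAddCommGroup H] [InnerProductSpace ℂ H]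
  {Γ L : H →ₗ.[ℂ] H} {lam : ℕ → ℝ} {e : HilbertBasis ℕ ℂ H}
  {A : ℝ} {φ₀ : H} {φ : ℝ → H} {τ : ℝ}

theorem lam_mul_sub_le (hs : HasPositiveDiscreteSpectrum Γ lam e) {x : H}
    (hx : x ∈ sobolevSpace lam e 1) (N : ℕ) :
    lam N * (‖x‖ ^ 2 - ∑ j ∈ Finset.range N, ‖inner ℂ (e j) x‖ ^ 2) ≤
      sobolevNorm lam e 1 x ^ 2 := by
  have hS := hasSum_sobolevNorm_one hs.lam_pos hx
  have hT := ((hasSum_normSq_inner e x).sub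
    (hasSum_sum_of_ne_finset_zero (s := Finset.range N)
      (f := fun j => if j ∈ Finset.range N then ‖inner ℂ (e j) x‖ ^ 2 else 0)
      fun j hj => if_neg hj)).mul_left (lam N)
  rw [Finset.sum_congr rfl fun j hj => if_pos hj] at hT
  refine hasSum_le (fun j => ?_) hT hS
  by_cases hj : j ∈ Finset.range N
  · rw [if_pos hj, sub_self, mul_zero]
    exact mul_nonneg (hs.lam_pos j).le (sq_nonneg _)
  · rw [if_neg hj, sub_zero]
    exact mul_le_mul_of_nonneg_right (hs.mono (by simpa using hj)) (sq_nonneg _)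

variable [CompleteSpace H]

theorem IsSolution.norm_le (hφ : IsSolution Γ L A φ₀ φ) (hΓ : IsSelfAdjoint Γ)
    (hs : HasPositiveDiscreteSpectrum Γ lam e) (hL : IsSymmetricOp L) {s t : ℝ} (h0 : 0 ≤ s)
    (hst : s ≤ t) : ‖φ t‖ ≤ ‖φ s‖ :=
  le_of_sq_le_sq (hφ.antitoneOn_normSq hΓ hs hL h0 (h0.trans hst) hst) (norm_nonneg _)

/-- The integrated energy identity, stated for continuous minorants `g` so that integrability of `‖φ
t‖₁²` never has to be shown. -/
theorem IsSolution.integral_le (hφ : IsSolution Γ L A φ₀ φ) (hΓ : IsSelfAdjoint Γ)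
    (hs : HasPositiveDiscreteSpectrum Γ lam e) (hL : IsSymmetricOp L) (h1 : ‖φ₀‖ = 1)
    (hτ : 0 ≤ τ) {g : ℝ → ℝ} (hg : ContinuousOn g (Ici 0))
    (hle : ∀ t ∈ Ioo 0 τ, g t ≤ sobolevNorm lam e 1 (φ t) ^ 2) :
    ∫ t in (0 : ℝ)..τ, g t ≤ 1 / 2 := by
  have hsub : Icc 0 τ ⊆ Ici 0 := fun t ht => ht.1
  have := intervalIntegral.integral_le_sub_of_hasDeriv_right_of_le hτ
    (g := fun s => -1 / 2 * ‖φ s‖ ^ 2)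
    (((hφ.continuousOn.norm.pow 2).const_mul _).mono hsub)
    (fun t ht => ((hφ.hasDerivAt_normSq hΓ hs hL ht.1).const_mul _).hasDerivWithinAt)
    ((hg.mono hsub).integrableOn_Icc)
    (fun t ht => (hle t ht).trans (le_of_eq (by ring)))
  rw [hφ.initial, h1] at this
  nlinarith [sq_nonneg ‖φ τ‖]

theorem IsSolution.sum_corr_le (hφ : IsSolution Γ L A φ₀ φ) (hΓ : IsSelfAdjoint Γ)
    (hs : HasPositiveDiscreteSpectrum Γ lam e) (hL : IsSymmetricOp L) (h1 : ‖φ₀‖ = 1)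
    (hτ : 0 ≤ τ) (N : ℕ) :
    ∑ j ∈ Finset.range N, lam j * (corr φ τ (e j) (e j)).re ≤ 1 / 2 := by
  have hcj : ∀ j, ContinuousOn (fun t => lam j * ‖inner ℂ (e j) (φ t)‖ ^ 2) (Ici 0) := fun j =>
    ((continuousOn_const.inner hφ.continuousOn).norm.pow 2).const_mul _
  have := hφ.integral_le hΓ hs hL h1 hτ
    (g := fun t => ∑ j ∈ Finset.range N, lam j * ‖inner ℂ (e j) (φ t)‖ ^ 2)
    (continuousOn_finsetSum _ fun j _ => hcj j) fun t ht => by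
      obtain ⟨k1, -, -⟩ := hφ.equation t ht.1
      exact sum_le_hasSum _ (fun j _ => mul_nonneg (hs.lam_pos j).le (sq_nonneg _))
        (hasSum_sobolevNorm_one hs.lam_pos (domain_subset_sobolevSpace hΓ hs k1))
  rw [intervalIntegral.integral_finsetSum fun j _ =>
    intervalIntegrable_of_continuousOn_Ici (hcj j) hτ] at this
  simpa only [intervalIntegral.integral_const_mul, ← corr_self_re] using this

/-- Until time `τ` the mass is at least `δ²` by monotonicity, and the energy bound leaves at most `1
/ (2 lam N)` of its time integral beyond the first `N` modes. -/
theorem IsSolution.le_sum_corr (hφ : IsSolution Γ L A φ₀ φ) (hΓ : IsSelfAdjoint Γ)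
    (hs : HasPositiveDiscreteSpectrum Γ lam e) (hL : IsSymmetricOp L) (h1 : ‖φ₀‖ = 1)
    (hτ : 0 ≤ τ) {δ : ℝ} (hδ : 0 ≤ δ) (hφτ : δ ≤ ‖φ τ‖) (N : ℕ) :
    lam N * (τ * δ ^ 2 - ∑ j ∈ Finset.range N, (corr φ τ (e j) (e j)).re) ≤ 1 / 2 := by
  have hcj : ∀ j, ContinuousOn (fun t => ‖inner ℂ (e j) (φ t)‖ ^ 2) (Ici 0) := fun j =>
    (continuousOn_const.inner hφ.continuousOn).norm.pow 2
  have hcs : ContinuousOn (fun t => ∑ j ∈ Finset.range N, ‖inner ℂ (e j) (φ t)‖ ^ 2) (Ici 0) :=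
    continuousOn_finsetSum _ fun j _ => hcj j
  have := hφ.integral_le hΓ hs hL h1 hτ
    (g := fun t => lam N * (δ ^ 2 - ∑ j ∈ Finset.range N, ‖inner ℂ (e j) (φ t)‖ ^ 2))
    ((continuousOn_const.sub hcs).const_mul _) fun t ht => by
      obtain ⟨k1, -, -⟩ := hφ.equation t ht.1
      refine le_trans ?_ (lam_mul_sub_le hs (domain_subset_sobolevSpace hΓ hs k1) N)
      have k2 : δ ≤ ‖φ t‖ := hφτ.trans (hφ.norm_le hΓ hs hL ht.1.le ht.2.le)
      refine mul_le_mul_of_nonneg_left ?_ (hs.lam_pos N).le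
      have := pow_le_pow_left₀ hδ k2 2
      linarith
  rw [intervalIntegral.integral_const_mul, intervalIntegral.integral_sub (by simp)
    (intervalIntegrable_of_continuousOn_Ici hcs hτ),
    intervalIntegral.integral_finsetSum fun j _ =>
    intervalIntegrable_of_continuousOn_Ici (hcj j) hτ] at this
  simpa only [intervalIntegral.integral_const, smul_eq_mul, sub_zero, ← corr_self_re] using this

/-- The correlation form of a solution almost commutes with `L` when `A` is large. -/
theorem IsSolution.norm_corr_sub_le (hφ : IsSolution Γ L A φ₀ φ) (hΓ : IsSelfAdjoint Γ)
    (hs : HasPositiveDiscreteSpectrum Γ lam e) (hL : IsSymmetricOp L) (h1 : ‖φ₀‖ = 1)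
    (hτ : 0 ≤ τ) {i j : ℕ} (hi : e i ∈ L.domain) (hj : e j ∈ L.domain) :
    |A| * ‖corr φ τ (L ⟨e i, hi⟩) (e j) - corr φ τ (e i) (L ⟨e j, hj⟩)‖ ≤
      2 + (lam i + lam j) * τ := by
  have hle : ∀ t, 0 ≤ t → ‖φ t‖ ≤ 1 := fun t ht => by
    simpa [hφ.initial, h1] using hφ.norm_le hΓ hs hL le_rfl ht
  have hc := hφ.continuousOn
  set F : ℝ → ℂ := fun t => inner ℂ (e i) (φ t) * inner ℂ (φ t) (e j) with hF
  have hFc : ContinuousOn F (Ici 0) := continuousOn_corr_integrand hc _ _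
  have c1 := continuousOn_corr_integrand hc (L ⟨e i, hi⟩) (e j)
  have c2 := continuousOn_corr_integrand hc (e i) (L ⟨e j, hj⟩)
  -- The commutator with `L` carries the factor `A`, while everything else in the equation is
  -- bounded independently of `A`.
  have hd : ∀ t, 0 < t → HasDerivAt F (Complex.I * A *
      (inner ℂ (L ⟨e i, hi⟩) (φ t) * inner ℂ (φ t) (e j) -
        inner ℂ (e i) (φ t) * inner ℂ (φ t) (L ⟨e j, hj⟩)) - (lam i + lam j) * F t) t := by
    intro t ht
    obtain ⟨k1, k2, hd⟩ := hφ.equation t ht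
    have hcoef : ∀ k (hk : e k ∈ L.domain),
        inner ℂ (e k) ((Complex.I * (A : ℂ)) • L ⟨φ t, k2⟩ - Γ ⟨φ t, k1⟩) =
          Complex.I * A * inner ℂ (L ⟨e k, hk⟩) (φ t) - lam k * inner ℂ (e k) (φ t) := by
      intro k hk
      rw [inner_sub_right, inner_smul_right, inner_basis_apply hΓ hs ⟨φ t, k1⟩,
        ← hL ⟨e k, hk⟩ ⟨φ t, k2⟩]
    have d1 : HasDerivAt (fun t => inner ℂ (e i) (φ t)) _ t :=
      ((innerSL ℂ (e i)).restrictScalars ℝ).hasFDerivAt.comp_hasDerivAt t hd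
    have d2 : HasDerivAt (fun t => inner ℂ (φ t) (e j))
        (inner ℂ ((Complex.I * (A : ℂ)) • L ⟨φ t, k2⟩ - Γ ⟨φ t, k1⟩) (e j)) t := by
      refine (hd.inner ℂ (hasDerivAt_const t (e j))).congr_deriv ?_
      rw [inner_zero_right, zero_add]
    refine (d1.mul d2).congr_deriv ?_
    change inner ℂ (e i) ((Complex.I * (A : ℂ)) • L ⟨φ t, k2⟩ - Γ ⟨φ t, k1⟩) * _ + _ = _
    rw [← inner_conj_symm ((Complex.I * (A : ℂ)) • L ⟨φ t, k2⟩ - Γ ⟨φ t, k1⟩) (e j), hcoef i hi,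
      hcoef j hj]
    simp only [hF, map_sub, map_mul, Complex.conj_I, Complex.conj_ofReal, inner_conj_symm]
    ring
  have hint := intervalIntegral.integral_eq_sub_of_hasDerivAt_of_le hτ
    (hFc.mono fun t ht => ht.1) (fun t ht => hd t ht.1)
    (intervalIntegrable_of_continuousOn_Ici
      (((c1.sub c2).const_mul _).sub (hFc.const_mul _)) hτ)
  have i1 := intervalIntegrable_of_continuousOn_Ici c1 hτ
  have i2 := intervalIntegrable_of_continuousOn_Ici c2 hτ
  have i3 := intervalIntegrable_of_continuousOn_Ici hFc hτ
  rw [intervalIntegral.integral_sub ((i1.sub i2).const_mul _) (i3.const_mul _),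
    intervalIntegral.integral_const_mul, intervalIntegral.integral_const_mul,
    intervalIntegral.integral_sub i1 i2] at hint
  change Complex.I * A * (corr φ τ (L ⟨e i, hi⟩) (e j) - corr φ τ (e i) (L ⟨e j, hj⟩)) -
    (lam i + lam j) * corr φ τ (e i) (e j) = F τ - F 0 at hint
  have hone : ∀ k, ‖e k‖ = 1 := fun k => e.orthonormal.norm_eq_one k
  have hFb : ∀ t, 0 ≤ t → ‖F t‖ ≤ 1 := by
    intro t ht
    have n1 := norm_inner_le_norm (𝕜 := ℂ) (e i) (φ t)
    have n2 := norm_inner_le_norm (𝕜 := ℂ) (φ t) (e j)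
    rw [hone, one_mul] at n1
    rw [hone, mul_one] at n2
    rw [hF, norm_mul]
    exact mul_le_one₀ (n1.trans (hle t ht)) (norm_nonneg _) (n2.trans (hle t ht))
  have hcb := norm_corr_le hle hτ (e i) (e j)
  rw [hone, hone, mul_one, mul_one] at hcb
  have hl : ‖((lam i : ℂ) + lam j)‖ = lam i + lam j := by
    rw [← Complex.ofReal_add, Complex.norm_real,
      Real.norm_of_nonneg (add_pos (hs.lam_pos i) (hs.lam_pos j)).le]
  calc |A| * ‖corr φ τ (L ⟨e i, hi⟩) (e j) - corr φ τ (e i) (L ⟨e j, hj⟩)‖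
      = ‖Complex.I * A * (corr φ τ (L ⟨e i, hi⟩) (e j) - corr φ τ (e i) (L ⟨e j, hj⟩))‖ := by
        rw [norm_mul, norm_mul, Complex.norm_I, one_mul, Complex.norm_real, Real.norm_eq_abs]
    _ = ‖F τ - F 0 + (lam i + lam j) * corr φ τ (e i) (e j)‖ := by rw [← hint, sub_add_cancel]
    _ ≤ (‖F τ‖ + ‖F 0‖) + (lam i + lam j) * ‖corr φ τ (e i) (e j)‖ := by
        refine (norm_add_le _ _).trans (add_le_add (norm_sub_le _ _) ?_)
        rw [norm_mul, hl]
    _ ≤ 2 + (lam i + lam j) * τ := by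
        have := hFb τ hτ
        have := hFb 0 le_rfl
        have := mul_le_mul_of_nonneg_left hcb (add_pos (hs.lam_pos i) (hs.lam_pos j)).le
        linarith

/-- If arbitrarily strong flows fail to relax some solution below `δ` by time `τ`, then `L` has an
eigenvector in `H^1`. -/
theorem exists_eigenvector_of_not_relaxation (hΓ : IsSelfAdjoint Γ)
    (hs : HasPositiveDiscreteSpectrum Γ lam e) (hL : IsSymmetricOp L)
    (hdom : sobolevSpace lam e 1 ⊆ (L.domain : Set H)) (hτ : 0 < τ) {δ : ℝ} (hδ : 0 < δ)
    (hno : ∀ A₀ : ℝ, ∃ A : ℝ, A₀ < A ∧ ∃ φ₀ : H, ‖φ₀‖ = 1 ∧ ∃ φ : ℝ → H,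
      IsSolution Γ L A φ₀ φ ∧ δ ≤ ‖φ τ‖) :
    ∃ ψ ∈ sobolevSpace lam e 1, IsEigenvector L ψ := by
  -- Taking the threshold `A₀ = n` forces `A n > n`, so `A n → ∞`.
  choose A hA x hx φ hφ hφδ using fun n : ℕ => hno n
  have hle : ∀ n t, 0 ≤ t → ‖φ n t‖ ≤ 1 := fun n t ht => by
    simpa [(hφ n).initial, hx n] using (hφ n).norm_le hΓ hs hL le_rfl ht
  obtain ⟨K, hKs, hK⟩ := exists_weak_limit (hyperfilter ℕ) (k := fun n => corr (φ n) τ) (M := τ)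
    (fun n => corr_add (hφ n).continuousOn hτ.le) (fun n => corr_smul) (fun n => corr_conj)
    (fun n => norm_corr_le (hle n) hτ.le)
  have hKre : ∀ u v, Tendsto (fun n => (corr (φ n) τ u v).re) (hyperfilter ℕ)
      (𝓝 (inner ℂ u (K v)).re) := fun u v => (Complex.continuous_re.tendsto _).comp (hK u v)
  -- Each bound involves finitely many entries, so it survives the weak limit.
  have htrace : ∀ N, ∑ j ∈ Finset.range N, lam j * (inner ℂ (e j) (K (e j))).re ≤ 1 / 2 := fun N =>
    le_of_tendsto (tendsto_finsetSum _ fun j _ => (hKre (e j) (e j)).const_mul (lam j))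
      (Eventually.of_forall fun n => (hφ n).sum_corr_le hΓ hs hL (hx n) hτ.le N)
  have hCS : ∀ u v, ‖inner ℂ u (K v)‖ ^ 2 ≤ τ * ‖v‖ ^ 2 * (inner ℂ u (K u)).re := fun u v =>
    le_of_tendsto_of_tendsto ((hK u v).norm.pow 2) ((hKre u u).const_mul _)
      (Eventually.of_forall fun n => normSq_corr_le (hφ n).continuousOn (hle n) hτ u v)
  have hweight : ∀ v, ∀ N, ∑ j ∈ Finset.range N, lam j * ‖inner ℂ (e j) (K v)‖ ^ 2 ≤
      τ / 2 * ‖v‖ ^ 2 := by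
    intro v N
    calc _ ≤ ∑ j ∈ Finset.range N, τ * ‖v‖ ^ 2 * (lam j * (inner ℂ (e j) (K (e j))).re) :=
          Finset.sum_le_sum fun j _ => by
            have := mul_le_mul_of_nonneg_left (hCS (e j) v) (hs.lam_pos j).le
            linarith
      _ = τ * ‖v‖ ^ 2 * ∑ j ∈ Finset.range N, lam j * (inner ℂ (e j) (K (e j))).re := by
          rw [Finset.mul_sum]
      _ ≤ τ * ‖v‖ ^ 2 * (1 / 2) := mul_le_mul_of_nonneg_left (htrace N) (by positivity)
      _ = _ := by ring
  have hKr : ∀ v, K v ∈ sobolevSpace lam e 1 := fun v => mem_sobolevSpace_one.2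
    (summable_of_sum_range_le (fun j => mul_nonneg (hs.lam_pos j).le (sq_nonneg _)) (hweight v))
  refine exists_isEigenvector_of_commute hL hdom
    (isCompactOperator_of_weighted_bound hs.lam_pos hs.mono hs.tendsto hweight) hKs ?_ hKr ?_
  -- If `K = 0`, the tail bound gives `lam N * (τ δ²) ≤ 1 / 2` for every `N`, contradicting `lam N →
  -- ∞`.
  · rintro rfl
    obtain ⟨N, hN⟩ := (hs.tendsto.eventually_gt_atTop (1 / (2 * (τ * δ ^ 2)))).exists
    have hlim := tendsto_finsetSum (Finset.range N) fun j _ => hKre (e j) (e j)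
    have := le_of_tendsto ((tendsto_const_nhds.sub hlim).const_mul (lam N))
      (Eventually.of_forall fun n =>
        (hφ n).le_sum_corr hΓ hs hL (hx n) hτ.le hδ.le (hφδ n) N)
    simp only [zero_apply, inner_zero_right, Complex.zero_re, Finset.sum_const_zero,
      sub_zero] at this
    rw [div_lt_iff₀ (by positivity)] at hN
    linarith
  · intro i j
    set hi := hdom (basis_mem_sobolevSpace (e := e) (lam := lam) i)
    set hj := hdom (basis_mem_sobolevSpace (e := e) (lam := lam) j)
    have l1 := (hK (L ⟨e i, hi⟩) (e j)).sub (hK (e i) (L ⟨e j, hj⟩))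
    have hAt : Tendsto A atTop atTop :=
      tendsto_atTop_mono (fun n => (hA n).le) tendsto_natCast_atTop_atTop
    have l2 : Tendsto (fun n => corr (φ n) τ (L ⟨e i, hi⟩) (e j) -
        corr (φ n) τ (e i) (L ⟨e j, hj⟩)) atTop (𝓝 0) := by
      refine squeeze_zero_norm' ?_ (hAt.const_div_atTop (2 + (lam i + lam j) * τ))
      filter_upwards [hAt.eventually_gt_atTop 0] with n hn
      have := (hφ n).norm_corr_sub_le hΓ hs hL (hx n) hτ.le hi hj
      rw [abs_of_pos hn] at this
      rw [le_div_iff₀ hn]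
      linarith
    exact sub_eq_zero.1 (tendsto_nhds_unique l1 (l2.mono_left Nat.hyperfilter_le_atTop))

end Sufficiency

end RelaxationEnhancing

theorem theorem3p3 {H : Type*} [NormedAddCommGroup H] [InnerProductSpace ℂ H] [CompleteSpace H]
    (Γ L : H →ₗ.[ℂ] H) (lam : ℕ → ℝ) (e : HilbertBasis ℕ ℂ H)
    (hΓ : IsSelfAdjoint Γ)
    (hspec : RelaxationEnhancing.HasPositiveDiscreteSpectrum Γ lam e)
    (hL : RelaxationEnhancing.IsSymmetricOp L)
    (hdom : RelaxationEnhancing.sobolevSpace lam e 1 ⊆ (L.domain : Set H))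
    (hbound : ∃ C : ℝ, ∀ ψ : L.domain, (ψ : H) ∈ RelaxationEnhancing.sobolevSpace lam e 1 →
      ‖L ψ‖ ≤ C * RelaxationEnhancing.sobolevNorm lam e 1 (ψ : H)) :
    -- the equation is well posed in `H`
    (∀ (A : ℝ) (φ₀ : H),
      (∃ φ : ℝ → H, RelaxationEnhancing.IsSolution Γ L A φ₀ φ) ∧
      ∀ φ φ' : ℝ → H, RelaxationEnhancing.IsSolution Γ L A φ₀ φ →
        RelaxationEnhancing.IsSolution Γ L A φ₀ φ' → EqOn φ φ' (Ici 0)) ∧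
    -- the equivalence
    ((∀ τ : ℝ, 0 < τ → ∀ δ : ℝ, 0 < δ → ∃ A₀ : ℝ, ∀ A : ℝ, A₀ < A →
        ∀ φ₀ : H, ‖φ₀‖ = 1 → ∀ φ : ℝ → H, RelaxationEnhancing.IsSolution Γ L A φ₀ φ →
          ‖φ τ‖ < δ) ↔
      ¬ ∃ ψ ∈ RelaxationEnhancing.sobolevSpace lam e 1, RelaxationEnhancing.IsEigenvector L ψ) := by
  have hex := RelaxationEnhancing.exists_isSolution hΓ hspec hL hdom hbound
  refine ⟨fun A φ₀ => ⟨hex A φ₀, fun φ φ' hφ hφ' => hφ.unique hφ' hΓ hspec hL⟩,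
    RelaxationEnhancing.no_eigenvector_of_relaxation hΓ hspec hL hex, fun hno τ hτ δ hδ => ?_⟩
  by_contra! hcon
  exact hno (RelaxationEnhancing.exists_eigenvector_of_not_relaxation hΓ hspec hL hdom hτ hδ hcon)
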